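/- **Setting.** Let $\mathbf G$ be a finite oriented metric graph: finite non-empty sets of vertices $\mathcal V$ and edges $\mathcal E$, where every edge $j$ has an initial and a terminal end point in $\mathcal V\cup\{\infty\}$, these two are different (so there are no loops; multiple edges are allowed), and $j$ is parametrized by an open interval $I_j$. This is a bounded interval $(a_j,b_j)$ if both end points are vertices (internal edge), $(a_j,+\infty)$ if only the initial end point is a vertex, and $(-\infty,b_j)$ if only the terminal one is (external edges); $a_j$ corresponds to the initial vertex and $b_j$ to the terminal vertex. Let $m\ge 0$ and $\mathscr H=\bigoplus_{j\in\mathcal E}L^2(I_j;\mathbb C^2)$. Let $D^{max}$ act in $\mathscr H$ as $-i\,\partial\otimes\sigma_1+m\,\sigma_3$ on every edge, with domain $\widetilde H^1=\bigoplus_{j}H^1(I_j;\mathbb C^2)$; here $\partial$ is the weak derivative and $\sigma_1=\begin{pmatrix}0&1\\1&0\end{pmatrix}$, $\sigma_3=\begin{pmatrix}1&0\\0&-1\end{pmatrix}$. Let $N$ be the number of pairs $(j,v)\in\mathcal E\times\mathcal V$ such that $v$ is an end point of $j$, and let $\nu_{\mathscr G},\nu_{\mathscr F}$ be two numberings (bijections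 from $\{1,\dots,N\}$ to the set of these pairs). For $\Phi=(\phi_j)_j\in\widetilde H^1$, $\phi_j=(\phi_j^1,\phi_j^2)$, let $\phi_j(v)$ be the boundary value at the end of $I_j$ that corresponds to $v$. Define $\Gamma^1,\Gamma^2:\widetilde H^1\to\mathbb C^N$ by: if $\nu_{\mathscr G}(n)=(j,v)$, then $(\Gamma^1\Phi)_n=\phi^1_j(v)$, and $(\Gamma^2\Phi)_n=i\phi_j^2(v)$ if $v$ is the initial vertex of $j$, $(\Gamma^2\Phi)_n=-i\phi_j^2(v)$ if $v$ is the terminal vertex of $j$. Let $W\in\mathbb C^{N\times N}$ be the permutation matrix with $W_{nk}=1$ if $\nu_{\mathscr F}(n)=\nu_{\mathscr G}(k)$ and $W_{nk}=0$ otherwise. Let $D^0$ be the restriction of $D^{max}$ to $\ker\Gamma^1$. For arbitrary matrices $A,B\in\mathbb C^{N\times N}$ (transmission conditions that may be local, i.e. not mixing different vertices, or non-local) let $D^{\Lambda_{A,B}}$ be the restriction of $D^{max}$ to $\{\Phi\in\widetilde H^1 : AW\Gamma^1\Phi=BW\Gamma^2\Phi\}$. Write $\sigma_p$ for the point spectrum,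 $\sigma$ for the spectrum and $\rho$ for the resolvent set. For $z\in\rho(D^0)$ let $\gamma(z)=(\Gamma^1\upharpoonright\ker(D^{max}-z))^{-1}:\mathbb C^N\to\mathscr H$ and $Q(z)=\Gamma^2\gamma(z)\in\mathbb C^{N\times N}$. **Theorem.** Let $z\in\rho(D^0)$. Then $\Gamma^1\upharpoonright\ker(D^{max}-z)$ is bijective, $\overline z\in\rho(D^0)$, and $\Gamma^1\upharpoonright\ker(D^{max}-\overline z)$ is bijective, so that $\gamma(z)$, $Q(z)$ and $\gamma(\overline z)$ are well defined, and: 1. $z\in\sigma_p(D^{\Lambda_{A,B}})$ if and only if $0\in\sigma\left(A-BWQ(z)W^{-1}\right)$. 2. $z\in\rho(D^{\Lambda_{A,B}})$ if and only if $0\in\rho\left(A-BWQ(z)W^{-1}\right)$. In this case $AW-BWQ(z)$ is invertible and $$(D^{\Lambda_{A,B}}-z)^{-1}=(D^0-z)^{-1}+\gamma(z)\left(AW-BWQ(z)\right)^{-1}BW\,\gamma(\overline z)^*.$$ -/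

import Mathlib

namespace DiracGraph

open MeasureTheory Set Filter
open scoped ENNReal ContDiff

theorem integral_deriv_smul_primitive {F : Type*} [NormedAddCommGroup F] [NormedSpace ℝ F]
    [CompleteSpace F] {φ : ℝ → ℝ} (hφ : ContDiff ℝ ∞ φ) (hc : HasCompactSupport φ)
    {H : ℝ → F} (hH : Integrable H) :
    ∫ x, deriv φ x • (∫ t in Iic x, H t) = - ∫ t, φ t • H t := by
  have hd : Integrable (deriv φ) :=
    (hφ.continuous_deriv (by norm_num)).integrable_of_hasCompactSupport hc.deriv
  have hprod : Integrable (fun p : ℝ × ℝ => ({p : ℝ × ℝ | p.2 ≤ p.1}).indicator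
      (fun p => deriv φ p.1 • H p.2) p) (volume.prod volume) :=
    (hd.smul_prod hH).indicator (measurableSet_le measurable_snd measurable_fst)
  have h1 : ∀ x, deriv φ x • (∫ t in Iic x, H t) =
      ∫ t, ({p : ℝ × ℝ | p.2 ≤ p.1}).indicator (fun p => deriv φ p.1 • H p.2) (x, t) := by
    intro x
    rw [← integral_indicator measurableSet_Iic, ← integral_smul]
    refine integral_congr_ae (Eventually.of_forall fun t => ?_)
    by_cases h : t ≤ x <;> simp [indicator, h]
  have h2 : ∀ t, ∫ x, ({p : ℝ × ℝ | p.2 ≤ p.1}).indicator (fun p => deriv φ p.1 • H p.2) (x, t)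
      = - (φ t • H t) := by
    intro t
    have : ∀ x, ({p : ℝ × ℝ | p.2 ≤ p.1}).indicator (fun p => deriv φ p.1 • H p.2) (x, t)
        = (Ici t).indicator (deriv φ) x • H t := by
      intro x
      by_cases h : t ≤ x <;> simp [indicator, h]
    simp_rw [this]
    rw [integral_smul_const, integral_indicator measurableSet_Ici, integral_Ici_eq_integral_Ioi,
      hc.integral_Ioi_deriv_eq (hφ.of_le (by norm_num)), neg_smul]
  simp_rw [h1]
  rw [integral_integral_swap hprod]
  simp_rw [h2]
  rw [integral_neg]

/-! ### Weak derivatives and Sobolev spaces -/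

section WeakDeriv

/-- A real-valued test function on `I`: smooth with compact support contained in `I`. -/
structure IsTest (I : Set ℝ) (φ : ℝ → ℝ) : Prop where
  contDiff : ContDiff ℝ ∞ φ
  hasCompactSupport : HasCompactSupport φ
  tsupport_subset : tsupport φ ⊆ I

/-- `g` is a weak derivative of `f` on `I`. -/
def IsWeakDeriv {F : Type*} [NormedAddCommGroup F] [NormedSpace ℝ F]
    (I : Set ℝ) (f g : ℝ → F) : Prop :=
  ∀ φ : ℝ → ℝ, IsTest I φ → ∫ x in I, deriv φ x • f x = - ∫ x in I, φ x • g x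

variable {F : Type*} [NormedAddCommGroup F] [NormedSpace ℝ F]

theorem exists_test {I : Set ℝ} (hI : IsOpen I) (hne : I.Nonempty) :
    ∃ χ, IsTest I χ ∧ ∫ x, χ x = 1 := by
  obtain ⟨x, hx⟩ := hne
  obtain ⟨ε, hε, hb⟩ := Metric.isOpen_iff.1 hI x hx
  let b : ContDiffBump x := ⟨ε / 4, ε / 2, by positivity, by linarith⟩
  refine ⟨b.normed volume, ⟨b.contDiff_normed, b.hasCompactSupport_normed, ?_⟩,
    b.integral_normed⟩
  rw [b.tsupport_normed_eq]
  exact (Metric.closedBall_subset_ball (by change ε / 2 < ε; linarith)).trans hb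

/-- A test function of zero integral on an interval is the derivative of a test function. -/
theorem exists_primitive {I : Set ℝ} (hc : I.OrdConnected) (hne : I.Nonempty)
    {θ : ℝ → ℝ} (hθ : IsTest I θ) (h0 : ∫ x, θ x = 0) :
    ∃ φ : ℝ → ℝ, ∃ p ∈ I, ∃ q ∈ I, p ≤ q ∧ IsTest I φ ∧ deriv φ = θ ∧
      (∀ x, x ∉ Icc p q → φ x = 0) ∧ (∀ x, x ∉ Icc p q → θ x = 0) := by
  obtain ⟨p, hp, q, hq, hpq, hK⟩ : ∃ p ∈ I, ∃ q ∈ I, p ≤ q ∧ tsupport θ ⊆ Icc p q := by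
    rcases (tsupport θ).eq_empty_or_nonempty with h | h
    · obtain ⟨x, hx⟩ := hne
      exact ⟨x, hx, x, hx, le_rfl, by simp [h]⟩
    · have hk : IsCompact (tsupport θ) := hθ.hasCompactSupport
      refine ⟨sInf (tsupport θ), hθ.tsupport_subset (hk.sInf_mem h), sSup (tsupport θ),
        hθ.tsupport_subset (hk.sSup_mem h), ?_, fun x hx =>
          ⟨csInf_le hk.bddBelow hx, le_csSup hk.bddAbove hx⟩⟩
      exact csInf_le hk.bddBelow (hk.sSup_mem h)
  have hz : ∀ x, x ∉ Icc p q → θ x = 0 := fun x hx =>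
    image_eq_zero_of_notMem_tsupport fun h => hx (hK h)
  have hcont := hθ.contDiff.continuous
  have hd : ∀ x, HasDerivAt (fun x => ∫ t in p..x, θ t) (θ x) x := fun x =>
    intervalIntegral.integral_hasDerivAt_right (hcont.intervalIntegrable _ _)
      (hcont.stronglyMeasurableAtFilter _ _) hcont.continuousAt
  have hderiv : deriv (fun x => ∫ t in p..x, θ t) = θ := funext fun x => (hd x).deriv
  have hint : Integrable θ := hcont.integrable_of_hasCompactSupport hθ.hasCompactSupport
  have htot : ∫ t in p..q, θ t = 0 := by
    rw [intervalIntegral.integral_of_le hpq, ← integral_Icc_eq_integral_Ioc,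
      setIntegral_eq_integral_of_forall_compl_eq_zero hz, h0]
  have hφz : ∀ x, x ∉ Icc p q → ∫ t in p..x, θ t = 0 := by
    intro x hx
    rcases lt_or_ge x p with h | h
    · rw [intervalIntegral.integral_congr_ae (g := fun _ => 0)]
      · simp
      · have : ∀ᵐ t : ℝ, t ≠ p := by simp [ae_iff]
        filter_upwards [this] with t ht h'
        rw [uIoc_of_ge h.le] at h'
        exact hz t fun h2 => ht (le_antisymm h'.2 h2.1)
    · have hxq : q < x := not_le.1 fun h2 => hx ⟨h, h2⟩
      rw [← intervalIntegral.integral_add_adjacent_intervals (b := q)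
        (hcont.intervalIntegrable _ _) (hcont.intervalIntegrable _ _), htot, zero_add,
        intervalIntegral.integral_congr_ae (g := fun _ => 0)]
      · simp
      · refine Eventually.of_forall fun t h' => ?_
        rw [uIoc_of_le hxq.le] at h'
        exact hz t fun h2 => absurd h2.2 (not_le.2 h'.1)
  have hts : tsupport (fun x => ∫ t in p..x, θ t) ⊆ Icc p q :=
    closure_minimal (fun x hx => by_contra fun h => hx (hφz x h)) isClosed_Icc
  refine ⟨fun x => ∫ t in p..x, θ t, p, hp, q, hq, hpq, ⟨?_, ?_, ?_⟩, hderiv, hφz, hz⟩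
  · rw [contDiff_infty_iff_deriv]
    exact ⟨fun x => (hd x).differentiableAt, by rw [hderiv]; exact hθ.contDiff⟩
  · exact HasCompactSupport.intro' isCompact_Icc isClosed_Icc hφz
  · exact hts.trans (hc.out hp hq)

theorem IsTest.integrable_smul {I : Set ℝ} {φ : ℝ → ℝ} (hφ : IsTest I φ) {f : ℝ → F}
    (hf : LocallyIntegrable f (volume.restrict I)) :
    Integrable (fun x => φ x • f x) (volume.restrict I) :=
  hf.integrable_smul_left_of_hasCompactSupport hφ.contDiff.continuous hφ.hasCompactSupport

theorem IsTest.deriv {I : Set ℝ} {φ : ℝ → ℝ} (hφ : IsTest I φ) : IsTest I (deriv φ) :=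
  ⟨(contDiff_infty_iff_deriv.1 hφ.contDiff).2, hφ.hasCompactSupport.deriv,
    (tsupport_deriv_subset).trans hφ.tsupport_subset⟩

theorem IsWeakDeriv.unique [CompleteSpace F] {I : Set ℝ} (hI : IsOpen I) {f g₁ g₂ : ℝ → F}
    (hg₁ : LocallyIntegrable g₁ (volume.restrict I))
    (hg₂ : LocallyIntegrable g₂ (volume.restrict I))
    (h₁ : IsWeakDeriv I f g₁) (h₂ : IsWeakDeriv I f g₂) :
    g₁ =ᵐ[volume.restrict I] g₂ := by
  have h := hI.ae_eq_zero_of_integral_contDiff_smul_eq_zero (μ := volume.restrict I)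
    (f := fun x => g₁ x - g₂ x) ((hg₁.sub hg₂).locallyIntegrableOn I) (by
      intro φ a b c
      have hφ : IsTest I φ := ⟨a, b, c⟩
      simp_rw [smul_sub]
      rw [integral_sub (hφ.integrable_smul hg₁) (hφ.integrable_smul hg₂), sub_eq_zero]
      exact neg_injective ((h₁ φ hφ).symm.trans (h₂ φ hφ)))
  filter_upwards [h, ae_restrict_mem hI.measurableSet] with x hx hxI
  exact sub_eq_zero.1 (hx hxI)

/-- A function with a locally integrable weak derivative on an open interval agrees almost
everywhere with a continuous function. -/
theorem IsWeakDeriv.exists_continuous [CompleteSpace F] {I : Set ℝ} (hI : IsOpen I) (hc : I.OrdConnected)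
    {f g : ℝ → F}
    (hf : LocallyIntegrable f (volume.restrict I))
    (hg : LocallyIntegrable g (volume.restrict I))
    (h : IsWeakDeriv I f g) : ∃ u : ℝ → F, Continuous u ∧ f =ᵐ[volume.restrict I] u := by
  rcases I.eq_empty_or_nonempty with rfl | hne
  · exact ⟨0, continuous_const, by simp [EventuallyEq]⟩
  obtain ⟨x₀, hx₀⟩ := id hne
  have hG : LocallyIntegrable (I.indicator g) := by
    intro x
    obtain ⟨s, hs, hi⟩ := hg x
    exact ⟨s, hs, by
      rw [IntegrableOn, integrable_indicator_iff hI.measurableSet, IntegrableOn,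
        Measure.restrict_restrict hI.measurableSet, inter_comm]
      rwa [IntegrableOn, Measure.restrict_restrict' hI.measurableSet] at hi⟩
  set G := I.indicator g with hGdef
  have hGi : ∀ a b, IntervalIntegrable G volume a b := fun a b =>
    (hG.integrableOn_isCompact isCompact_uIcc).intervalIntegrable
  let P : ℝ → F := fun x => ∫ t in x₀..x, G t
  have hP : Continuous P := intervalIntegral.continuous_primitive hGi x₀
  have hPl : LocallyIntegrable P (volume.restrict I) := hP.locallyIntegrable
  have hl := hf.sub hPl
  have key : ∀ θ, IsTest I θ → ∫ x, θ x = 0 → ∫ x in I, θ x • (f x - P x) = 0 := by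
    intro θ hθ h0
    obtain ⟨φ, p, hp, q, hq, hpq, hφ, rfl, hφz, hz⟩ := exists_primitive hc hne hθ h0
    have e1 := h φ hφ
    have hHi : Integrable ((Ioc p q).indicator G) :=
      (integrable_indicator_iff measurableSet_Ioc).2 ((hGi p q).1)
    have e2 := integral_deriv_smul_primitive hφ.contDiff hφ.hasCompactSupport hHi
    have e3 : ∫ t, φ t • (Ioc p q).indicator G t = ∫ x in I, φ x • g x := by
      rw [← integral_indicator hI.measurableSet]
      have : ∀ᵐ t : ℝ, t ≠ p := by simp [ae_iff]
      refine integral_congr_ae ?_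
      filter_upwards [this] with t ht
      by_cases h1 : t ∈ Icc p q
      · have h2 : t ∈ Ioc p q := ⟨lt_of_le_of_ne h1.1 ht.symm, h1.2⟩
        have h3 : t ∈ I := hc.out hp hq h1
        simp [h2, h3, hGdef]
      · by_cases h3 : t ∈ I <;> simp [hφz t h1, h3]
    have e4 : ∀ x, deriv φ x • (∫ t in Iic x, (Ioc p q).indicator G t)
        = deriv φ x • P x - deriv φ x • P p := by
      intro x
      by_cases h1 : x ∈ Icc p q
      · rw [← smul_sub, setIntegral_indicator measurableSet_Ioc,
          intervalIntegral.integral_interval_sub_left (hGi _ _) (hGi _ _),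
          intervalIntegral.integral_of_le h1.1]
        congr 3
        ext t
        simp only [mem_inter_iff, mem_Iic, mem_Ioc]
        exact ⟨fun h => ⟨h.2.1, h.1⟩, fun h => ⟨h.2, h.1, h.2.trans h1.2⟩⟩
      · simp [hz x h1]
    have hdi := hφ.deriv.contDiff.continuous.integrable_of_hasCompactSupport (μ := volume)
      hφ.deriv.hasCompactSupport
    have e5 : ∫ x, deriv φ x • P x = ∫ x in I, deriv φ x • P x := by
      refine (setIntegral_eq_integral_of_forall_compl_eq_zero fun x hx => ?_).symm
      rw [hz x fun h1 => hx (hc.out hp hq h1), zero_smul]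
    simp_rw [e4] at e2
    have hdP : Integrable (fun x => deriv φ x • P x) :=
      (hφ.deriv.contDiff.continuous.smul hP).integrable_of_hasCompactSupport
        hφ.deriv.hasCompactSupport.smul_right
    rw [integral_sub hdP (hdi.smul_const _), integral_smul_const, h0,
      zero_smul, sub_zero, e3, e5] at e2
    simp_rw [smul_sub]
    rw [integral_sub (hφ.deriv.integrable_smul hf) (hφ.deriv.integrable_smul hPl), e1, e2,
      sub_self]
  obtain ⟨χ, hχ, hχ1⟩ := exists_test hI hne
  set c := ∫ x in I, χ x • (f x - P x) with hcdef
  have h := hI.ae_eq_zero_of_integral_contDiff_smul_eq_zero (μ := volume.restrict I)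
    (f := fun x => (f x - P x) - c)
    ((hl.sub continuous_const.locallyIntegrable).locallyIntegrableOn I) (by
      intro ψ a b d
      have hψ : IsTest I ψ := ⟨a, b, d⟩
      have hψi := a.continuous.integrable_of_hasCompactSupport (μ := volume) b
      have hχi := hχ.contDiff.continuous.integrable_of_hasCompactSupport (μ := volume)
        hχ.hasCompactSupport
      have hθ : IsTest I (fun x => ψ x - (∫ t, ψ t) * χ x) :=
        ⟨a.sub (contDiff_const.mul hχ.contDiff), b.sub hχ.hasCompactSupport.mul_left,
          (tsupport_sub _ _).trans (union_subset d
            ((tsupport_mul_subset_right).trans hχ.tsupport_subset))⟩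
      have := key _ hθ (by
        rw [integral_sub hψi (hχi.const_mul _), integral_const_mul, hχ1, mul_one, sub_self])
      simp_rw [sub_smul, mul_smul] at this
      have hψl : Integrable (fun x => ψ x • (f x - P x)) (volume.restrict I) :=
        hψ.integrable_smul hl
      have hχl : Integrable (fun x => (∫ t, ψ t) • χ x • (f x - P x)) (volume.restrict I) :=
        (hχ.integrable_smul hl).smul (∫ t, ψ t)
      rw [integral_sub hψl hχl, integral_smul] at this
      simp_rw [smul_sub _ _ c]
      have hψI : ∫ x in I, ψ x = ∫ x, ψ x :=
        setIntegral_eq_integral_of_forall_compl_eq_zero fun x hx =>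
          image_eq_zero_of_notMem_tsupport fun h => hx (d h)
      rw [integral_sub hψl (hψi.restrict.smul_const c), integral_smul_const,
        hψI]
      exact this)
  refine ⟨fun x => P x + c, hP.add continuous_const, ?_⟩
  filter_upwards [h, ae_restrict_mem hI.measurableSet] with x hx hxI
  have := hx hxI
  rw [sub_sub, sub_eq_zero] at this
  exact this

end WeakDeriv

/-- The spinor space `ℂ²`. -/
abbrev Spinor : Type := EuclideanSpace ℂ (Fin 2)

/-- `L²(I; ℂ²)`. -/
abbrev L2 (I : Set ℝ) : Type := Lp Spinor 2 (volume.restrict I)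

theorem L2.locallyIntegrable {I : Set ℝ} (f : L2 I) :
    LocallyIntegrable f (volume.restrict I) :=
  (Lp.memLp f).locallyIntegrable (by norm_num)

theorem IsWeakDeriv.add {I : Set ℝ} {f₁ f₂ g₁ g₂ : L2 I} (h₁ : IsWeakDeriv I f₁ g₁)
    (h₂ : IsWeakDeriv I f₂ g₂) : IsWeakDeriv I (f₁ + f₂ : L2 I) (g₁ + g₂ : L2 I) := by
  intro φ hφ
  have e1 : ∫ x in I, deriv φ x • (f₁ + f₂ : L2 I) x
      = ∫ x in I, (deriv φ x • f₁ x + deriv φ x • f₂ x) := by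
    refine integral_congr_ae ?_
    filter_upwards [Lp.coeFn_add f₁ f₂] with x hx
    rw [hx, Pi.add_apply, smul_add]
  have e2 : ∫ x in I, φ x • (g₁ + g₂ : L2 I) x
      = ∫ x in I, (φ x • g₁ x + φ x • g₂ x) := by
    refine integral_congr_ae ?_
    filter_upwards [Lp.coeFn_add g₁ g₂] with x hx
    rw [hx, Pi.add_apply, smul_add]
  rw [e1, e2, integral_add (hφ.deriv.integrable_smul f₁.locallyIntegrable)
    (hφ.deriv.integrable_smul f₂.locallyIntegrable),
    integral_add (hφ.integrable_smul g₁.locallyIntegrable)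
    (hφ.integrable_smul g₂.locallyIntegrable), h₁ φ hφ, h₂ φ hφ, neg_add]

theorem IsWeakDeriv.smul {I : Set ℝ} (c : ℂ) {f g : L2 I} (h : IsWeakDeriv I f g) :
    IsWeakDeriv I (c • f : L2 I) (c • g : L2 I) := by
  intro φ hφ
  have e1 : ∫ x in I, deriv φ x • (c • f : L2 I) x = ∫ x in I, c • (deriv φ x • f x) := by
    refine integral_congr_ae ?_
    filter_upwards [Lp.coeFn_smul c f] with x hx
    rw [hx, Pi.smul_apply, smul_comm]
  have e2 : ∫ x in I, φ x • (c • g : L2 I) x = ∫ x in I, c • (φ x • g x) := by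
    refine integral_congr_ae ?_
    filter_upwards [Lp.coeFn_smul c g] with x hx
    rw [hx, Pi.smul_apply, smul_comm]
  rw [e1, e2, integral_smul, integral_smul, h φ hφ, smul_neg]

/-- The Sobolev space `H¹(I; ℂ²)`: elements of `L²(I; ℂ²)` with a weak derivative in
`L²(I; ℂ²)`. -/
def sobolevH1 (I : Set ℝ) : Submodule ℂ (L2 I) where
  carrier := {f | ∃ g : L2 I, IsWeakDeriv I f g}
  add_mem' := fun ⟨g₁, h₁⟩ ⟨g₂, h₂⟩ => ⟨g₁ + g₂, h₁.add h₂⟩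
  zero_mem' := ⟨0, by simpa using (IsWeakDeriv.smul (0 : ℂ) (f := (0 : L2 I)) (g := 0) (by
    intro φ _
    have h0 : ((0 : L2 I) : ℝ → Spinor) =ᵐ[volume.restrict I] 0 := Lp.coeFn_zero _ _ _
    rw [integral_congr_ae (g := 0) (by filter_upwards [h0] with x hx; simp only [hx, Pi.zero_apply, smul_zero]),
      integral_congr_ae (g := 0) (f := fun x => φ x • (0 : L2 I) x)
        (by filter_upwards [h0] with x hx; simp only [hx, Pi.zero_apply, smul_zero])]
    simp))⟩
  smul_mem' := fun c _ ⟨g, h⟩ => ⟨c • g, h.smul c⟩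

open Classical in
/-- The weak derivative `∂f` of `f ∈ H¹(I; ℂ²)` (and `0` for `f ∉ H¹`). -/
noncomputable def weakDeriv {I : Set ℝ} (f : L2 I) : L2 I :=
  if h : ∃ g : L2 I, IsWeakDeriv I f g then h.choose else 0

theorem isWeakDeriv_weakDeriv {I : Set ℝ} {f : L2 I} (hf : f ∈ sobolevH1 I) :
    IsWeakDeriv I f (weakDeriv f) := by
  have h : ∃ g : L2 I, IsWeakDeriv I f g := hf
  rw [weakDeriv, dif_pos h]
  exact h.choose_spec

theorem weakDeriv_eq {I : Set ℝ} (hI : IsOpen I) {f g : L2 I} (h : IsWeakDeriv I f g) :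
    weakDeriv f = g :=
  Lp.ext (IsWeakDeriv.unique hI (L2.locallyIntegrable _) g.locallyIntegrable
    (isWeakDeriv_weakDeriv ⟨g, h⟩) h)

/-- `c` is the boundary value of `f` at `p`: some representative of `f` which is continuous on
the closure of `I` takes the value `c` at `p`. -/
def HasBoundaryValue {I : Set ℝ} (f : L2 I) (p : ℝ) (c : Spinor) : Prop :=
  ∃ u : ℝ → Spinor, ContinuousOn u (closure I) ∧ f =ᵐ[volume.restrict I] u ∧ u p = c

open Classical in
/-- The value `f(p)` at a point `p` of the closure of `I` of the continuous representative
of `f`. -/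
noncomputable def boundaryValue {I : Set ℝ} (f : L2 I) (p : ℝ) : Spinor :=
  if h : ∃ c, HasBoundaryValue f p c then h.choose else 0

theorem HasBoundaryValue.unique {I : Set ℝ} (hI : IsOpen I) {f : L2 I} {p : ℝ}
    (hp : p ∈ closure I) {c₁ c₂ : Spinor} (h₁ : HasBoundaryValue f p c₁)
    (h₂ : HasBoundaryValue f p c₂) : c₁ = c₂ := by
  obtain ⟨u, hu, hfu, rfl⟩ := h₁
  obtain ⟨v, hv, hfv, rfl⟩ := h₂
  have h : EqOn u v I := Measure.eqOn_open_of_ae_eq (hfu.symm.trans hfv) hI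
    (hu.mono subset_closure) (hv.mono subset_closure)
  exact h.of_subset_closure hu hv subset_closure subset_rfl hp

theorem boundaryValue_eq {I : Set ℝ} (hI : IsOpen I) {f : L2 I} {p : ℝ}
    (hp : p ∈ closure I) {c : Spinor} (h : HasBoundaryValue f p c) :
    boundaryValue f p = c := by
  have h' : ∃ c, HasBoundaryValue f p c := ⟨c, h⟩
  rw [boundaryValue, dif_pos h']
  exact h'.choose_spec.unique hI hp h

theorem hasBoundaryValue_boundaryValue {I : Set ℝ} (hI : IsOpen I) (hc : I.OrdConnected)
    {f : L2 I} (hf : f ∈ sobolevH1 I) (p : ℝ) :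
    HasBoundaryValue f p (boundaryValue f p) := by
  obtain ⟨g, hg⟩ := hf
  obtain ⟨u, hu, hfu⟩ := hg.exists_continuous hI hc f.locallyIntegrable g.locallyIntegrable
  have h' : ∃ c, HasBoundaryValue f p c := ⟨u p, u, hu.continuousOn, hfu, rfl⟩
  rw [boundaryValue, dif_pos h']
  exact h'.choose_spec

theorem HasBoundaryValue.add {I : Set ℝ} {f₁ f₂ : L2 I} {p : ℝ} {c₁ c₂ : Spinor}
    (h₁ : HasBoundaryValue f₁ p c₁) (h₂ : HasBoundaryValue f₂ p c₂) :
    HasBoundaryValue (f₁ + f₂) p (c₁ + c₂) := by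
  obtain ⟨u, hu, hfu, rfl⟩ := h₁
  obtain ⟨v, hv, hfv, rfl⟩ := h₂
  exact ⟨u + v, hu.add hv, (Lp.coeFn_add f₁ f₂).trans (hfu.add hfv), rfl⟩

theorem HasBoundaryValue.smul {I : Set ℝ} (a : ℂ) {f : L2 I} {p : ℝ} {c : Spinor}
    (h : HasBoundaryValue f p c) : HasBoundaryValue (a • f) p (a • c) := by
  obtain ⟨u, hu, hfu, rfl⟩ := h
  exact ⟨a • u, hu.const_smul a, (Lp.coeFn_smul a f).trans (hfu.const_smul a), rfl⟩

/-! ### Metric graphs -/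

/-- An oriented metric graph with vertex set `V` and edge set `E`. The element `⊤ : WithTop V`
is the end point at infinity. An edge is internal if both its end points are vertices and
external otherwise; loops are excluded, and every edge has at least one end point in `V`.
Edge `j` is parametrized by the interval `(left j, right j)`, where `left j` is replaced by
`-∞` if `tail j = ⊤`, and `right j` by `+∞` if `head j = ⊤`. -/
structure MetricGraph (V E : Type*) where
  /-- the initial end point of an edge -/
  tail : E → WithTop V
  /-- the terminal end point of an edge -/
  head : E → WithTop V
  tail_ne_head : ∀ j, tail j ≠ head j
  left : E → ℝ
  right : E → ℝ
  left_lt_right : ∀ j, tail j ≠ ⊤ → head j ≠ ⊤ → left j < right j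

namespace MetricGraph

variable {V E : Type*} (G : MetricGraph V E)

/-- The interval `I_j` associated with the edge `j`. -/
def interval (j : E) : Set ℝ :=
  {x | (G.tail j ≠ ⊤ → G.left j < x) ∧ (G.head j ≠ ⊤ → x < G.right j)}

/-- The incident pairs: edges `j` together with a vertex `v` which is an end point of `j`. -/
def Incidence : Type _ :=
  {p : E × V // G.tail p.1 = (p.2 : WithTop V) ∨ G.head p.1 = (p.2 : WithTop V)}

open Classical in
/-- The end point of the interval `I_j` that corresponds to the vertex `v`. -/
noncomputable def endpoint (q : G.Incidence) : ℝ :=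
  if G.tail q.1.1 = (q.1.2 : WithTop V) then G.left q.1.1 else G.right q.1.1

open Classical in
/-- The entry `G_{v,j}` of the incidence matrix: `-1` if `v` is the initial and `1` if `v` is
the terminal vertex of `j`. -/
noncomputable def sign (q : G.Incidence) : ℂ :=
  if G.tail q.1.1 = (q.1.2 : WithTop V) then -1 else 1

theorem isOpen_interval (j : E) : IsOpen (G.interval j) := by
  have h : G.interval j = {x | G.tail j ≠ ⊤ → G.left j < x} ∩
    {x | G.head j ≠ ⊤ → x < G.right j} := rfl
  rw [h]
  have h1 : IsOpen {x | G.left j < x} := isOpen_Ioi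
  have h2 : IsOpen {x | x < G.right j} := isOpen_Iio
  refine IsOpen.inter ?_ ?_
  · by_cases h : G.tail j = ⊤ <;> simp [h, h1]
  · by_cases h : G.head j = ⊤ <;> simp [h, h2]

theorem ordConnected_interval (j : E) : (G.interval j).OrdConnected :=
  ⟨fun _ hx _ hy _ hz => ⟨fun h => (hx.1 h).trans_le hz.1, fun h => hz.2.trans_lt (hy.2 h)⟩⟩

theorem endpoint_mem_closure (q : G.Incidence) :
    G.endpoint q ∈ closure (G.interval q.1.1) := by
  obtain ⟨⟨j, v⟩, hq⟩ := q
  dsimp only [endpoint]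
  by_cases ht : G.tail j = ⊤
  · have hh : G.head j ≠ ⊤ := fun h => G.tail_ne_head j (ht.trans h.symm)
    have hI : G.interval j = Iio (G.right j) := by ext; simp [interval, ht, hh]
    rw [hI, if_neg (by simp [ht]), closure_Iio]
    exact self_mem_Iic
  · by_cases hh : G.head j = ⊤
    · have hI : G.interval j = Ioi (G.left j) := by ext; simp [interval, ht, hh]
      rw [hI, if_pos (by simpa [hh] using hq), closure_Ioi]
      exact self_mem_Ici
    · have hlt := G.left_lt_right j ht hh
      have hI : G.interval j = Ioo (G.left j) (G.right j) := by ext; simp [interval, ht, hh]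
      rw [hI, closure_Ioo hlt.ne]
      split_ifs
      · exact left_mem_Icc.2 hlt.le
      · exact right_mem_Icc.2 hlt.le

variable [Fintype E]

/-- The Hilbert space `ℋ = ⨁_j L²(I_j; ℂ²)`. -/
abbrev Space : Type _ := PiLp 2 (fun j => L2 (G.interval j))

/-- The Sobolev space `⨁_j H¹(I_j; ℂ²)` on the graph. -/
def H1 : Submodule ℂ G.Space where
  carrier := {Φ | ∀ j, Φ j ∈ sobolevH1 (G.interval j)}
  add_mem' := fun h₁ h₂ j => (sobolevH1 _).add_mem (h₁ j) (h₂ j)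
  zero_mem' := fun _ => (sobolevH1 _).zero_mem
  smul_mem' := fun c _ h j => (sobolevH1 _).smul_mem c (h j)

end MetricGraph

/-- The Pauli matrix `σ₁`. -/
def pauli1 : Matrix (Fin 2) (Fin 2) ℂ := !![0, 1; 1, 0]

/-- The Pauli matrix `σ₃`. -/
def pauli3 : Matrix (Fin 2) (Fin 2) ℂ := !![1, 0; 0, -1]

/-- The pointwise action `(M f)(x) = M (f(x))` of a matrix `M` on `f ∈ L²(I; ℂ²)`. -/
noncomputable def matAct {I : Set ℝ} (M : Matrix (Fin 2) (Fin 2) ℂ) : L2 I →L[ℂ] L2 I :=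
  (Matrix.toEuclideanCLM (n := Fin 2) (𝕜 := ℂ) M).compLpL 2 (volume.restrict I)

/-! ### Unbounded operators -/

section Operators

variable {H : Type*} [NormedAddCommGroup H] [InnerProductSpace ℂ H]

/-- The point spectrum of a linear operator `T` in `H`. -/
def pointSpectrum (T : H →ₗ.[ℂ] H) : Set ℂ :=
  {z | ∃ φ : T.domain, φ ≠ 0 ∧ T φ = z • (φ : H)}

/-- The bounded operator `R` is an everywhere defined two-sided inverse of `T - z`. -/
def IsResolvent (T : H →ₗ.[ℂ] H) (z : ℂ) (R : H →L[ℂ] H) : Prop :=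
  (∀ f : H, ∃ h : R f ∈ T.domain, T ⟨R f, h⟩ - z • R f = f) ∧
    ∀ φ : T.domain, R (T φ - z • (φ : H)) = φ

/-- The resolvent set `ρ(T)`: those `z` for which `T - z` has a bounded everywhere defined
inverse. -/
def rho (T : H →ₗ.[ℂ] H) : Set ℂ :=
  {z | ∃ R : H →L[ℂ] H, IsResolvent T z R}

open Classical in
/-- The resolvent `(T - z)⁻¹` for `z ∈ ρ(T)` (and `0` for other `z`). -/
noncomputable def resolventOp (T : H →ₗ.[ℂ] H) (z : ℂ) : H →L[ℂ] H :=
  if h : ∃ R : H →L[ℂ] H, IsResolvent T z R then h.choose else 0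

variable {K : Type*} [NormedAddCommGroup K] [InnerProductSpace ℂ K]

/-- The restriction of `T` to `{φ ∈ Dom T | (Γ¹φ, Γ²φ) ∈ Λ}`. -/
def restrictTo (T : H →ₗ.[ℂ] H) (Γ₁ Γ₂ : T.domain →ₗ[ℂ] K) (Λ : Submodule ℂ (K × K)) :
    H →ₗ.[ℂ] H :=
  T.domRestrict ((Λ.comap (Γ₁.prod Γ₂)).map T.domain.subtype)

/-- The defect subspace `N_z = ker (T - z)`, as a subspace of `Dom T`. -/
def defect (T : H →ₗ.[ℂ] H) (z : ℂ) : Submodule ℂ T.domain :=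
  LinearMap.ker (T.toFun - z • T.domain.subtype)

open Classical in
/-- `(Γ¹ ↾ N_z)⁻¹` with values in `Dom T`, if `Γ¹ ↾ N_z` is bijective (and `0` otherwise). -/
noncomputable def kreinGammaDom (T : H →ₗ.[ℂ] H) (Γ₁ : T.domain →ₗ[ℂ] K) (z : ℂ) :
    K →ₗ[ℂ] T.domain :=
  if h : Function.Bijective (Γ₁.domRestrict (defect T z)) then
    (defect T z).subtype ∘ₗ (LinearEquiv.ofBijective _ h).symm.toLinearMap
  else 0

/-- The Krein `γ`-field `γ(z) = (Γ¹ ↾ N_z)⁻¹ : K → H`. -/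
noncomputable def kreinGamma [FiniteDimensional ℂ K] (T : H →ₗ.[ℂ] H)
    (Γ₁ : T.domain →ₗ[ℂ] K) (z : ℂ) : K →L[ℂ] H :=
  LinearMap.toContinuousLinearMap (T.domain.subtype ∘ₗ kreinGammaDom T Γ₁ z)

/-- The Krein `Q`-function `Q(z) = Γ² γ(z)`. -/
noncomputable def kreinQ (T : H →ₗ.[ℂ] H) (Γ₁ Γ₂ : T.domain →ₗ[ℂ] K) (z : ℂ) : K →ₗ[ℂ] K :=
  Γ₂ ∘ₗ kreinGammaDom T Γ₁ z

end Operators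

/-! ### The Dirac operator on a graph -/

namespace MetricGraph

variable {V E : Type*} [Fintype E] (G : MetricGraph V E)

/-- The maximal Dirac operator on the graph: `-i ∂ ⊗ σ₁ + m ⊗ σ₃` on each edge, with domain
`⨁_j H¹(I_j; ℂ²)`. -/
noncomputable def diracMax (m : ℝ) : G.Space →ₗ.[ℂ] G.Space where
  domain := G.H1
  toFun :=
    { toFun := fun Φ => WithLp.toLp 2 fun j =>
        (-Complex.I) • matAct pauli1 (weakDeriv ((Φ : G.Space) j))
          + (m : ℂ) • matAct pauli3 ((Φ : G.Space) j)
      map_add' := fun Φ Ψ => by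
        ext1 j
        have h : weakDeriv (((Φ + Ψ : G.H1) : G.Space) j)
            = weakDeriv ((Φ : G.Space) j) + weakDeriv ((Ψ : G.Space) j) :=
          weakDeriv_eq (G.isOpen_interval j)
            ((isWeakDeriv_weakDeriv (Φ.2 j)).add (isWeakDeriv_weakDeriv (Ψ.2 j)))
        change (-Complex.I) • matAct pauli1 (weakDeriv (((Φ + Ψ : G.H1) : G.Space) j))
          + (m : ℂ) • matAct pauli3 ((Φ : G.Space) j + (Ψ : G.Space) j) = (_ + _) + (_ + _)
        rw [h, map_add, map_add, smul_add, smul_add]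
        exact add_add_add_comm _ _ _ _
      map_smul' := fun c Φ => by
        ext1 j
        have h : weakDeriv (((c • Φ : G.H1) : G.Space) j)
            = c • weakDeriv ((Φ : G.Space) j) :=
          weakDeriv_eq (G.isOpen_interval j) ((isWeakDeriv_weakDeriv (Φ.2 j)).smul c)
        change (-Complex.I) • matAct pauli1 (weakDeriv (((c • Φ : G.H1) : G.Space) j))
          + (m : ℂ) • matAct pauli3 (c • (Φ : G.Space) j) = c • (_ + _)
        rw [h, map_smul, map_smul, smul_add, smul_comm c, smul_comm c (m : ℂ)] }

/-- The value `φ_j(v) ∈ ℂ²` of `Φ` along the edge `j` at its end point `v`. -/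
noncomputable def value (q : G.Incidence) : G.H1 →ₗ[ℂ] Spinor where
  toFun Φ := boundaryValue ((Φ : G.Space) q.1.1) (G.endpoint q)
  map_add' := fun Φ Ψ => boundaryValue_eq (G.isOpen_interval _) (G.endpoint_mem_closure q)
    ((hasBoundaryValue_boundaryValue (G.isOpen_interval _) (G.ordConnected_interval _)
      (Φ.2 _) _).add (hasBoundaryValue_boundaryValue (G.isOpen_interval _)
      (G.ordConnected_interval _) (Ψ.2 _) _))
  map_smul' := fun c Φ => boundaryValue_eq (G.isOpen_interval _) (G.endpoint_mem_closure q)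
    ((hasBoundaryValue_boundaryValue (G.isOpen_interval _) (G.ordConnected_interval _)
      (Φ.2 _) _).smul c)

variable {N : ℕ}

/-- The boundary map `Γ¹`, the boundary space `⨁_j 𝒢_j` being identified with `ℂᴺ` by a
numbering `ν` of the incident pairs: the component of `Γ¹Φ` at `(j, v)` is `φ_j¹(v)`. -/
noncomputable def bd1 (ν : Fin N ≃ G.Incidence) : G.H1 →ₗ[ℂ] EuclideanSpace ℂ (Fin N) where
  toFun Φ := WithLp.toLp 2 fun n => G.value (ν n) Φ 0
  map_add' Φ Ψ := by ext n; simp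
  map_smul' c Φ := by ext n; simp

/-- The boundary map `Γ²`: the component of `Γ²Φ` at `(j, v)` is `i φ_j²(v)` if `v` is the
initial vertex of `j` and `-i φ_j²(v)` if `v` is the terminal vertex of `j`. -/
noncomputable def bd2 (ν : Fin N ≃ G.Incidence) : G.H1 →ₗ[ℂ] EuclideanSpace ℂ (Fin N) where
  toFun Φ := WithLp.toLp 2 fun n => -Complex.I * G.sign (ν n) * G.value (ν n) Φ 1
  map_add' Φ Ψ := by ext n; simp [mul_add]
  map_smul' c Φ := by ext n; simp; ring

/-- The reference operator `D⁰`: the restriction of `D^max` to `ker Γ¹`, i.e. to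
`{Φ | (Γ¹Φ, Γ²Φ) ∈ {0} ⊕ 𝒢}`. -/
noncomputable def dirac0 (m : ℝ) (ν : Fin N ≃ G.Incidence) : G.Space →ₗ.[ℂ] G.Space :=
  restrictTo (G.diracMax m) (G.bd1 ν) (G.bd2 ν) (Submodule.prod ⊥ ⊤)

variable {G}

open Classical in
/-- The permutation matrix `W` from the numbering `νG` of the boundary space to the numbering
`νF` of the vertex space. -/
noncomputable def W (νG νF : Fin N ≃ G.Incidence) : Matrix (Fin N) (Fin N) ℂ :=
  Matrix.of fun n k => if νF n = νG k then 1 else 0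

/-- The linear relation `Λ_{A,B} = {(f, f') | A W f = B W f'}` in the boundary space. -/
noncomputable def relAB (νG νF : Fin N ≃ G.Incidence) (A B : Matrix (Fin N) (Fin N) ℂ) :
    Submodule ℂ (EuclideanSpace ℂ (Fin N) × EuclideanSpace ℂ (Fin N)) :=
  LinearMap.eqLocus (Matrix.toEuclideanLin (A * W νG νF) ∘ₗ LinearMap.fst ℂ _ _)
    (Matrix.toEuclideanLin (B * W νG νF) ∘ₗ LinearMap.snd ℂ _ _)

variable (G)

/-- The Dirac operator `D^{Λ_{A,B}}`: the restriction of `D^max` to those `Φ` with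
`A W Γ¹Φ = B W Γ²Φ`. -/
noncomputable def diracAB (m : ℝ) (νG νF : Fin N ≃ G.Incidence)
    (A B : Matrix (Fin N) (Fin N) ℂ) : G.Space →ₗ.[ℂ] G.Space :=
  restrictTo (G.diracMax m) (G.bd1 νG) (G.bd2 νG) (relAB νG νF A B)

/-- The `γ`-field of the boundary triple `(Γ¹, Γ², ℂᴺ)` of `D^max`. -/
noncomputable def gammaField (m : ℝ) (ν : Fin N ≃ G.Incidence) (z : ℂ) :
    EuclideanSpace ℂ (Fin N) →L[ℂ] G.Space :=
  kreinGamma (G.diracMax m) (G.bd1 ν) z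

/-- The matrix of the Krein `Q`-function of the boundary triple `(Γ¹, Γ², ℂᴺ)` of `D^max`. -/
noncomputable def Q (m : ℝ) (ν : Fin N ≃ G.Incidence) (z : ℂ) : Matrix (Fin N) (Fin N) ℂ :=
  Matrix.toEuclideanLin.symm (kreinQ (G.diracMax m) (G.bd1 ν) (G.bd2 ν) z)

end MetricGraph

end DiracGraph

/-!
The proof is the boundary-triple argument for Krein's resolvent formula. Two facts about the
maximal operator `D = D^max` carry it.

* *Green's identity* (`MetricGraph.green`):
  `⟨Ψ, DΦ⟩ - ⟨DΨ, Φ⟩ = ⟨Γ¹Ψ, Γ²Φ⟩ - ⟨Γ²Ψ, Γ¹Φ⟩`. Every element of `H¹` of an interval is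
  represented by a primitive of its weak derivative (`IsWeakDeriv.exists_isPrimitive`), so the
  identity is the product rule for absolutely continuous functions and the fundamental theorem of
  calculus on each edge; at an infinite end the boundary term vanishes because an integrable
  function with a limit has limit zero.
* *Surjectivity of `Γ¹`* (`MetricGraph.bd1_surjective`), by bump functions at the ends of the edges.

Let `z ∈ ρ(D⁰)`. If `Γ¹Φ = ξ`, then `Φ - (D⁰ - z)⁻¹ (D - z) Φ` lies in `ker (D - z)` and has the
same boundary value, and an element of `ker (D - z)` with `Γ¹ = 0` lies in `ker (D⁰ - z)`, so
it vanishes; hence `Γ¹` is bijective on `ker (D - z)` (`bijective_domRestrict_defect`).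
That `z̄ ∈ ρ(D⁰)` is not derived from self-adjointness but from the symmetry `(φ¹, φ²) ↦ (conj φ¹, -conj φ²)`, a
bounded conjugate-linear involution which commutes with `D` and preserves `ker Γ¹`
(`MetricGraph.conj_mem_rho_dirac0`).

An element `γ(z)ξ` of `ker (D - z)` satisfies `A W Γ¹ = B W Γ²` if and only if
`(A W - B W Q(z)) ξ = 0`, which gives the eigenvalue criterion
(`mem_pointSpectrum_restrictTo_iff`). If `M = A W - B W Q(z)` is invertible, then
`(D⁰ - z)⁻¹ f + γ(z) M⁻¹ B W Γ² (D⁰ - z)⁻¹ f` solves `(D - z) Φ = f` with the transmission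
condition, and Green's identity gives `Γ² (D⁰ - z)⁻¹ = γ(z̄)^*`, which proves Krein's formula and
the boundedness of the inverse (`isResolvent_krein`). If `M` is not invertible, then `z` is an
eigenvalue, so it is not in the resolvent set.
-/

namespace DiracGraph

open MeasureTheory Set Filter
open scoped ENNReal ContDiff Topology ComplexConjugate InnerProductSpace

/-! ### Primitives and weak derivatives on an interval -/

section Primitive

variable {F : Type*} [NormedAddCommGroup F] [NormedSpace ℝ F]

/-- `u` is a primitive of the locally integrable function `g` on the whole line; equivalently, `u`
is locally absolutely continuous and `u' = g` almost everywhere. -/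
structure IsPrimitive (u g : ℝ → F) : Prop where
  locallyIntegrable : LocallyIntegrable g
  sub_eq : ∀ a b, u b - u a = ∫ x in a..b, g x

theorem isPrimitive_integral {g : ℝ → F} (hg : LocallyIntegrable g) (c : ℝ) :
    IsPrimitive (fun x => ∫ t in c..x, g t) g where
  locallyIntegrable := hg
  sub_eq _ _ := intervalIntegral.integral_interval_sub_left
    (hg.integrableOn_isCompact isCompact_uIcc).intervalIntegrable
    (hg.integrableOn_isCompact isCompact_uIcc).intervalIntegrable

namespace IsPrimitive

variable {u v g h : ℝ → F}

theorem intervalIntegrable (hu : IsPrimitive u g) (a b : ℝ) : IntervalIntegrable g volume a b :=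
  (hu.locallyIntegrable.integrableOn_isCompact isCompact_uIcc).intervalIntegrable

theorem eq_add (hu : IsPrimitive u g) (a b : ℝ) : u b = u a + ∫ x in a..b, g x := by
  rw [← hu.sub_eq, add_sub_cancel]

theorem continuous (hu : IsPrimitive u g) : Continuous u := by
  rw [show u = fun x => u 0 + ∫ t in (0 : ℝ)..x, g t from funext (hu.eq_add 0)]
  exact continuous_const.add (intervalIntegral.continuous_primitive hu.intervalIntegrable 0)

theorem add (hu : IsPrimitive u g) (hv : IsPrimitive v h) :
    IsPrimitive (fun x => u x + v x) (fun x => g x + h x) where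
  locallyIntegrable := hu.locallyIntegrable.add hv.locallyIntegrable
  sub_eq a b := by
    rw [intervalIntegral.integral_add (hu.intervalIntegrable a b) (hv.intervalIntegrable a b),
      ← hu.sub_eq, ← hv.sub_eq]
    abel

theorem add_const (hu : IsPrimitive u g) (c : F) : IsPrimitive (fun x => u x + c) g :=
  ⟨hu.locallyIntegrable, fun a b => by rw [add_sub_add_right_eq_sub, hu.sub_eq]⟩

theorem clm_apply [CompleteSpace F] {F' : Type*} [NormedAddCommGroup F'] [NormedSpace ℝ F']
    [CompleteSpace F'] (L : F →L[ℝ] F') (hu : IsPrimitive u g) :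
    IsPrimitive (fun x => L (u x)) (fun x => L (g x)) where
  locallyIntegrable x := by
    obtain ⟨s, hs, hi⟩ := hu.locallyIntegrable x
    exact ⟨s, hs, L.integrable_comp hi⟩
  sub_eq a b := by
    rw [← map_sub, hu.sub_eq, L.intervalIntegral_comp_comm (hu.intervalIntegrable a b)]

theorem absolutelyContinuousOnInterval (hu : IsPrimitive u g) (a b : ℝ) :
    AbsolutelyContinuousOnInterval u a b := by
  -- increments of `u` are bounded by those of the real-valued primitive of `‖g‖`
  have hn : IntervalIntegrable (fun x => ‖g x‖) volume a b := (hu.intervalIntegrable a b).norm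
  have hi := hn.absolutelyContinuousOnInterval_intervalIntegral (c := a) left_mem_uIcc
  refine squeeze_zero (fun _ => Finset.sum_nonneg fun _ _ => dist_nonneg)
    (fun t => Finset.sum_le_sum fun i _ => ?_) hi
  have hn' : ∀ c d, IntervalIntegrable (fun x => ‖g x‖) volume c d := fun c d =>
    (hu.intervalIntegrable c d).norm
  rw [dist_comm, dist_comm (∫ _ in _.._, _), dist_eq_norm, dist_eq_norm, hu.sub_eq,
    intervalIntegral.integral_interval_sub_left (hn' _ _) (hn' _ _)]
  exact intervalIntegral.norm_integral_le_abs_integral_norm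

theorem ae_hasDerivAt [CompleteSpace F] (hu : IsPrimitive u g) : ∀ᵐ x, HasDerivAt u (g x) x := by
  filter_upwards [LocallyIntegrable.ae_hasDerivAt_integral hu.locallyIntegrable] with x hx
  rw [show u = fun x => u 0 + ∫ t in (0 : ℝ)..x, g t from funext (hu.eq_add 0)]
  simpa using (hx 0).const_add (u 0)

/-- The product rule for locally absolutely continuous functions. -/
theorem smul [CompleteSpace F] {𝕜 : Type*} [RCLike 𝕜] [NormedSpace 𝕜 F] [IsScalarTower ℝ 𝕜 F]
    {p q : ℝ → 𝕜} (hp : IsPrimitive p q) (hu : IsPrimitive u g) :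
    IsPrimitive (fun x => p x • u x) (fun x => p x • g x + q x • u x) := by
  have hl : LocallyIntegrable (fun x => p x • g x + q x • u x) :=
    (hu.locallyIntegrable.continuous_smul hp.continuous).add
      (hp.locallyIntegrable.smul_continuous hu.continuous)
  refine ⟨hl, fun a b => ?_⟩
  have hac := ((hp.absolutelyContinuousOnInterval a b).smul
    (hu.absolutelyContinuousOnInterval a b)).sub
    ((isPrimitive_integral hl a).absolutelyContinuousOnInterval a b)
  obtain ⟨C, hC⟩ := hac.const_of_ae_hasDerivAt_zero (by
    filter_upwards [hp.ae_hasDerivAt, hu.ae_hasDerivAt,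
      (isPrimitive_integral hl a).ae_hasDerivAt] with x h1 h2 h3 _
    simpa using (h1.smul h2).sub h3)
  have ha := hC a left_mem_uIcc
  have hb := hC b right_mem_uIcc
  simp only [Pi.sub_apply, Pi.smul_apply', intervalIntegral.integral_same, sub_zero] at ha hb
  rw [ha, ← hb]
  abel

theorem of_deriv {φ : ℝ → ℝ} (hφ : ContDiff ℝ 1 φ) : IsPrimitive φ (deriv φ) where
  locallyIntegrable := (hφ.continuous_deriv le_rfl).locallyIntegrable
  sub_eq a b := (intervalIntegral.integral_deriv_eq_sub
    (fun x _ => (hφ.differentiable one_ne_zero) x)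
    ((hφ.continuous_deriv le_rfl).intervalIntegrable a b)).symm

/-- A primitive with compact support: the integral of its derivative vanishes. -/
theorem integral_eq_zero (hu : IsPrimitive u g) (hc : HasCompactSupport u)
    (hg : HasCompactSupport g) : ∫ x, g x = 0 := by
  obtain ⟨r, hr⟩ := (hc.isCompact.union hg.isCompact).isBounded.subset_closedBall 0
  have hz : ∀ x, x ∉ Icc (-r) r → u x = 0 ∧ g x = 0 := fun x hx => by
    rw [Real.closedBall_eq_Icc, zero_sub, zero_add] at hr
    exact ⟨image_eq_zero_of_notMem_tsupport fun h => hx (hr (Or.inl h)),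
      image_eq_zero_of_notMem_tsupport fun h => hx (hr (Or.inr h))⟩
  have hs : ∀ x, x ∉ Ioc (-(|r| + 1)) (|r| + 1) → g x = 0 := fun x hx =>
    (hz x fun h => hx ⟨by linarith [le_abs_self r, h.1], by linarith [le_abs_self r, h.2]⟩).2
  have hr0 := abs_nonneg r
  rw [← setIntegral_eq_integral_of_forall_compl_eq_zero hs,
    ← intervalIntegral.integral_of_le (by linarith), ← hu.sub_eq,
    (hz (|r| + 1) fun h => by linarith [le_abs_self r, h.2]).1,
    (hz (-(|r| + 1)) fun h => by linarith [le_abs_self r, h.1]).1, sub_zero]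

/-- A locally absolutely continuous function has its almost everywhere derivative as weak
derivative. -/
theorem isWeakDeriv [CompleteSpace F] (hu : IsPrimitive u g) (I : Set ℝ) :
    IsWeakDeriv I u g := by
  intro φ hφ
  have hp := (of_deriv (hφ.contDiff.of_le (by norm_num))).smul hu
  have h0 := hp.integral_eq_zero hφ.hasCompactSupport.smul_right
    (hφ.hasCompactSupport.smul_right.add hφ.hasCompactSupport.deriv.smul_right)
  have hz : ∀ x, x ∉ I → φ x = 0 := fun x hx =>
    image_eq_zero_of_notMem_tsupport fun h => hx (hφ.tsupport_subset h)
  have hz' : ∀ x, x ∉ I → deriv φ x = 0 := fun x hx =>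
    image_eq_zero_of_notMem_tsupport fun h => hx (hφ.deriv.tsupport_subset h)
  rw [setIntegral_eq_integral_of_forall_compl_eq_zero fun x hx => by rw [hz' x hx, zero_smul],
    setIntegral_eq_integral_of_forall_compl_eq_zero fun x hx => by rw [hz x hx, zero_smul]]
  rw [integral_add] at h0
  · exact eq_neg_of_add_eq_zero_right h0
  · exact hu.locallyIntegrable.integrable_smul_left_of_hasCompactSupport hφ.contDiff.continuous
      hφ.hasCompactSupport
  · exact (hu.continuous.locallyIntegrable).integrable_smul_left_of_hasCompactSupport
      hφ.deriv.contDiff.continuous hφ.hasCompactSupport.deriv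

theorem congr_ae {g' : ℝ → F} (hu : IsPrimitive u g) (h : g =ᵐ[volume] g') : IsPrimitive u g' where
  locallyIntegrable x := by
    obtain ⟨s, hs, hi⟩ := hu.locallyIntegrable x
    exact ⟨s, hs, hi.congr (ae_restrict_of_ae h)⟩
  sub_eq a b := by
    rw [hu.sub_eq, intervalIntegral.integral_congr_ae (h.mono fun _ hx _ => hx)]

theorem setIntegral_Ioo (hu : IsPrimitive u g) {a b : ℝ} (hab : a ≤ b) :
    ∫ x in Ioo a b, g x = u b - u a := by
  rw [hu.sub_eq, intervalIntegral.integral_of_le hab, integral_Ioc_eq_integral_Ioo]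

theorem setIntegral_Ioi (hu : IsPrimitive u g) {a : ℝ} (hui : IntegrableOn u (Ioi a))
    (hg : IntegrableOn g (Ioi a)) : ∫ x in Ioi a, g x = -u a := by
  have h1 := (intervalIntegral_tendsto_integral_Ioi a hg tendsto_id).const_add (u a)
  have h2 : Tendsto u atTop (𝓝 (u a + ∫ x in Ioi a, g x)) :=
    h1.congr fun x => (hu.eq_add a x).symm
  have h3 := IntegrableAtFilter.eq_zero_of_tendsto (μ := volume) ⟨Ioi a, Ioi_mem_atTop a, hui⟩
    (fun s hs => by
      obtain ⟨b, hb⟩ := mem_atTop_sets.1 hs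
      rw [← top_le_iff, ← Real.volume_Ici (a := b)]
      exact measure_mono hb) h2
  exact (neg_eq_of_add_eq_zero_right h3).symm

theorem setIntegral_Iio (hu : IsPrimitive u g) {b : ℝ} (hui : IntegrableOn u (Iio b))
    (hg : IntegrableOn g (Iio b)) : ∫ x in Iio b, g x = u b := by
  rw [← integral_Iic_eq_integral_Iio]
  have hg' : IntegrableOn g (Iic b) := (integrableOn_Iic_iff_integrableOn_Iio).2 hg
  have h1 := (intervalIntegral_tendsto_integral_Iic b hg' tendsto_id).const_sub (u b)
  have h2 : Tendsto u atBot (𝓝 (u b - ∫ x in Iic b, g x)) :=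
    h1.congr fun x => by rw [id, ← hu.sub_eq, sub_sub_cancel]
  have h3 := IntegrableAtFilter.eq_zero_of_tendsto (μ := volume) ⟨Iio b, Iio_mem_atBot b, hui⟩
    (fun s hs => by
      obtain ⟨b, hb⟩ := mem_atBot_sets.1 hs
      rw [← top_le_iff, ← Real.volume_Iic (a := b)]
      exact measure_mono hb) h2
  exact (sub_eq_zero.1 h3).symm

end IsPrimitive

/-- A locally integrable function with vanishing weak derivative on an open interval is almost
everywhere constant there. -/
theorem IsWeakDeriv.exists_ae_eq_const [CompleteSpace F] {I : Set ℝ} (hI : IsOpen I)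
    (hc : I.OrdConnected) {w : ℝ → F} (hw : LocallyIntegrable w (volume.restrict I))
    (h : IsWeakDeriv I w 0) : ∃ c, w =ᵐ[volume.restrict I] fun _ => c := by
  rcases I.eq_empty_or_nonempty with rfl | hne
  · exact ⟨0, by simp [EventuallyEq]⟩
  obtain ⟨χ, hχ, hχ1⟩ := exists_test hI hne
  refine ⟨∫ x in I, χ x • w x, ?_⟩
  have key := hI.ae_eq_zero_of_integral_contDiff_smul_eq_zero (μ := volume.restrict I)
    (f := fun x => w x - ∫ x in I, χ x • w x)
    ((hw.sub continuous_const.locallyIntegrable).locallyIntegrableOn I) (by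
      intro ψ a b d
      have hψ : IsTest I ψ := ⟨a, b, d⟩
      have hψi := a.continuous.integrable_of_hasCompactSupport (μ := volume) b
      have hχi := hχ.contDiff.continuous.integrable_of_hasCompactSupport (μ := volume)
        hχ.hasCompactSupport
      -- `ψ - (∫ ψ) χ` has zero integral, hence is the derivative of a test function
      have hθ : IsTest I (fun x => ψ x - (∫ t, ψ t) * χ x) :=
        ⟨a.sub (contDiff_const.mul hχ.contDiff), b.sub hχ.hasCompactSupport.mul_left,
          (tsupport_sub _ _).trans (union_subset d
            ((tsupport_mul_subset_right).trans hχ.tsupport_subset))⟩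
      obtain ⟨φ, -, -, -, -, -, hφ, hd, -, -⟩ := exists_primitive hc hne hθ (by
        rw [integral_sub hψi (hχi.const_mul _), integral_const_mul, hχ1, mul_one, sub_self])
      have h0 := h φ hφ
      rw [hd] at h0
      simp only [Pi.zero_apply, smul_zero, integral_zero, neg_zero, sub_smul, mul_smul] at h0
      have hψl := hψ.integrable_smul hw
      have hχl : Integrable (fun x => (∫ t, ψ t) • χ x • w x) (volume.restrict I) :=
        (hχ.integrable_smul hw).smul (∫ t, ψ t)
      rw [integral_sub hψl hχl, integral_smul] at h0
      simp_rw [smul_sub]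
      have hψI : ∫ x in I, ψ x = ∫ x, ψ x :=
        setIntegral_eq_integral_of_forall_compl_eq_zero fun x hx =>
          image_eq_zero_of_notMem_tsupport fun h => hx (d h)
      rw [integral_sub hψl (hψi.restrict.smul_const _), integral_smul_const, hψI]
      exact h0)
  filter_upwards [key, ae_restrict_mem hI.measurableSet] with x hx hxI
  exact sub_eq_zero.1 (hx hxI)

/-- A function with a locally integrable weak derivative `g` on an open interval `I` has a
representative which is a primitive, on the whole line, of the extension of `g` by zero. -/
theorem IsWeakDeriv.exists_isPrimitive [CompleteSpace F] {I : Set ℝ} (hI : IsOpen I)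
    (hc : I.OrdConnected) {f g : ℝ → F} (hf : LocallyIntegrable f (volume.restrict I))
    (hg : LocallyIntegrable g (volume.restrict I)) (h : IsWeakDeriv I f g) :
    ∃ u, IsPrimitive u (I.indicator g) ∧ f =ᵐ[volume.restrict I] u := by
  have hG : LocallyIntegrable (I.indicator g) := by
    intro x
    obtain ⟨s, hs, hi⟩ := hg x
    exact ⟨s, hs, by
      rw [IntegrableOn, integrable_indicator_iff hI.measurableSet, IntegrableOn,
        Measure.restrict_restrict hI.measurableSet, inter_comm]
      rwa [IntegrableOn, Measure.restrict_restrict' hI.measurableSet] at hi⟩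
  have hP := isPrimitive_integral hG 0
  have hPl : LocallyIntegrable (fun x => ∫ t in (0 : ℝ)..x, I.indicator g t)
    (volume.restrict I) := hP.continuous.locallyIntegrable
  obtain ⟨c, hc⟩ := IsWeakDeriv.exists_ae_eq_const hI hc
    (w := fun x => f x - ∫ t in (0 : ℝ)..x, I.indicator g t) (hf.sub hPl) (by
      intro φ hφ
      simp_rw [smul_sub]
      rw [integral_sub (hφ.deriv.integrable_smul hf) (hφ.deriv.integrable_smul hPl), h φ hφ,
        hP.isWeakDeriv I φ hφ, setIntegral_congr_fun hI.measurableSet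
          (g := fun x => φ x • g x) (f := fun x => φ x • I.indicator g x)
          (fun x hx => by simp [hx])]
      simp)
  refine ⟨_, hP.add_const c, ?_⟩
  filter_upwards [hc] with x hx
  rw [← hx]
  abel

end Primitive

theorem IsWeakDeriv.congr_ae {F : Type*} [NormedAddCommGroup F] [NormedSpace ℝ F] {I : Set ℝ}
    {f f' g g' : ℝ → F} (h : IsWeakDeriv I f g) (hf : f' =ᵐ[volume.restrict I] f)
    (hg : g' =ᵐ[volume.restrict I] g) : IsWeakDeriv I f' g' := by
  intro φ hφ
  have e1 : (fun x => deriv φ x • f' x) =ᵐ[volume.restrict I] fun x => deriv φ x • f x :=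
    hf.mono fun x hx => congrArg (deriv φ x • ·) hx
  have e2 : (fun x => φ x • g' x) =ᵐ[volume.restrict I] fun x => φ x • g x :=
    hg.mono fun x hx => congrArg (φ x • ·) hx
  rw [integral_congr_ae e1, integral_congr_ae e2, h φ hφ]

theorem IsWeakDeriv.clm_apply {F F' : Type*} [NormedAddCommGroup F] [NormedSpace ℝ F]
    [CompleteSpace F] [NormedAddCommGroup F'] [NormedSpace ℝ F'] [CompleteSpace F'] (L : F →L[ℝ] F')
    {I : Set ℝ} {f g : ℝ → F} (hf : LocallyIntegrable f (volume.restrict I))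
    (hg : LocallyIntegrable g (volume.restrict I)) (h : IsWeakDeriv I f g) :
    IsWeakDeriv I (fun x => L (f x)) (fun x => L (g x)) := by
  intro φ hφ
  simp_rw [← map_smul]
  rw [L.integral_comp_comm (hφ.deriv.integrable_smul hf),
    L.integral_comp_comm (hφ.integrable_smul hg), h φ hφ, map_neg]

/-! ### Boundary triples and Krein's resolvent formula -/

section AbstractOperators

variable {H K : Type*} [NormedAddCommGroup H] [InnerProductSpace ℂ H]
  [NormedAddCommGroup K] [InnerProductSpace ℂ K]

theorem IsResolvent.unique {T : H →ₗ.[ℂ] H} {z : ℂ} {R R' : H →L[ℂ] H} (h : IsResolvent T z R)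
    (h' : IsResolvent T z R') : R = R' := by
  ext f
  obtain ⟨hd, he⟩ := h.1 f
  have := h'.2 ⟨R f, hd⟩
  rw [he] at this
  exact this.symm

theorem IsResolvent.resolventOp_eq {T : H →ₗ.[ℂ] H} {z : ℂ} {R : H →L[ℂ] H}
    (h : IsResolvent T z R) : resolventOp T z = R := by
  have h' : ∃ R : H →L[ℂ] H, IsResolvent T z R := ⟨R, h⟩
  rw [resolventOp, dif_pos h']
  exact h'.choose_spec.unique h

theorem isResolvent_resolventOp {T : H →ₗ.[ℂ] H} {z : ℂ} (h : z ∈ rho T) :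
    IsResolvent T z (resolventOp T z) := by
  obtain ⟨R, hR⟩ := h
  rwa [hR.resolventOp_eq]

theorem notMem_pointSpectrum_of_mem_rho {T : H →ₗ.[ℂ] H} {z : ℂ} (h : z ∈ rho T) :
    z ∉ pointSpectrum T := by
  rintro ⟨φ, h0, hφ⟩
  obtain ⟨R, hR⟩ := h
  have := hR.2 φ
  rw [hφ, sub_self, map_zero] at this
  exact h0 (Subtype.ext this.symm)

/-- If `T` commutes with a bounded conjugate-linear involution `C`, then `ρ(T)` is invariant under
complex conjugation: `C (T - z)⁻¹ C` is a resolvent at `z̄`. -/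
theorem conj_mem_rho {T : H →ₗ.[ℂ] H} (C : H →SL[starRingEnd ℂ] H) (hC : ∀ f, C (C f) = f)
    (hT : ∀ φ : T.domain, ∃ h : C φ ∈ T.domain, T ⟨C φ, h⟩ = C (T φ)) {z : ℂ}
    (hz : z ∈ rho T) : conj z ∈ rho T := by
  obtain ⟨R, hR⟩ := hz
  refine ⟨(C.comp R).comp C, fun f => ?_, fun φ => ?_⟩
  · obtain ⟨hd, he⟩ := hR.1 (C f)
    obtain ⟨hd', he'⟩ := hT ⟨R (C f), hd⟩
    refine ⟨hd', ?_⟩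
    change T ⟨C (R (C f)), hd'⟩ - conj z • C (R (C f)) = f
    rw [he', ← map_smulₛₗ, ← map_sub, he, hC]
  · obtain ⟨hd, he⟩ := hT φ
    have := hR.2 ⟨C φ, hd⟩
    change C (R (C (T φ - conj z • (φ : H)))) = φ
    rw [map_sub, map_smulₛₗ, ← he, Complex.conj_conj, this, hC]

variable {T : H →ₗ.[ℂ] H} {Γ₁ Γ₂ : T.domain →ₗ[ℂ] K}

theorem mem_restrictTo_domain {Λ : Submodule ℂ (K × K)} (φ : T.domain) :
    (φ : H) ∈ (restrictTo T Γ₁ Γ₂ Λ).domain ↔ (Γ₁ φ, Γ₂ φ) ∈ Λ := by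
  change (φ : H) ∈ _ ⊓ T.domain ↔ _
  simp only [Submodule.mem_inf, SetLike.coe_mem, and_true, Submodule.mem_map, Submodule.mem_comap]
  exact ⟨fun ⟨ψ, h, e⟩ => by rwa [← Subtype.ext e], fun h => ⟨φ, h, rfl⟩⟩

theorem restrictTo_apply {Λ : Submodule ℂ (K × K)} (φ : (restrictTo T Γ₁ Γ₂ Λ).domain)
    (ψ : T.domain) (h : (φ : H) = ψ) : restrictTo T Γ₁ Γ₂ Λ φ = T ψ :=
  LinearPMap.domRestrict_apply h

theorem exists_of_mem_restrictTo_domain {Λ : Submodule ℂ (K × K)}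
    (φ : (restrictTo T Γ₁ Γ₂ Λ).domain) : ∃ ψ : T.domain, (φ : H) = ψ ∧ (Γ₁ ψ, Γ₂ ψ) ∈ Λ := by
  have h : (φ : H) ∈ T.domain := φ.2.2
  exact ⟨⟨φ, h⟩, rfl, (mem_restrictTo_domain (Γ₁ := Γ₁) (Γ₂ := Γ₂) ⟨φ, h⟩).1 φ.2⟩

theorem conj_mem_rho_restrictTo (C : H →SL[starRingEnd ℂ] H) (hC : ∀ f, C (C f) = f)
    {Λ : Submodule ℂ (K × K)}
    (hT : ∀ φ : T.domain, ∃ h : C φ ∈ T.domain, T ⟨C φ, h⟩ = C (T φ) ∧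
      ((Γ₁ φ, Γ₂ φ) ∈ Λ → (Γ₁ ⟨C φ, h⟩, Γ₂ ⟨C φ, h⟩) ∈ Λ))
    {z : ℂ} (hz : z ∈ rho (restrictTo T Γ₁ Γ₂ Λ)) : conj z ∈ rho (restrictTo T Γ₁ Γ₂ Λ) := by
  refine conj_mem_rho C hC (fun φ => ?_) hz
  obtain ⟨ψ, hψ, hm⟩ := exists_of_mem_restrictTo_domain φ
  obtain ⟨h, he, hi⟩ := hT ψ
  have hd := (mem_restrictTo_domain ⟨C ψ, h⟩).2 (hi hm)
  refine ⟨hψ ▸ hd, ?_⟩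
  rw [restrictTo_apply _ ⟨C ψ, h⟩ (congrArg C hψ), he, restrictTo_apply φ ψ hψ]

theorem mem_defect {z : ℂ} {φ : T.domain} : φ ∈ defect T z ↔ T φ = z • (φ : H) := by
  rw [defect, LinearMap.mem_ker]
  exact sub_eq_zero

/-- `IsResolvent` for a restriction of `T`, expressed within the domain of `T`. -/
theorem IsResolvent.exists_of_restrictTo {Λ : Submodule ℂ (K × K)} {z : ℂ} {R : H →L[ℂ] H}
    (h : IsResolvent (restrictTo T Γ₁ Γ₂ Λ) z R) (f : H) :
    ∃ φ : T.domain, (φ : H) = R f ∧ (Γ₁ φ, Γ₂ φ) ∈ Λ ∧ T φ - z • (φ : H) = f := by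
  obtain ⟨hd, he⟩ := h.1 f
  obtain ⟨ψ, hψ, hm⟩ := exists_of_mem_restrictTo_domain ⟨R f, hd⟩
  refine ⟨ψ, hψ.symm, hm, ?_⟩
  rw [restrictTo_apply _ ψ hψ] at he
  rwa [← hψ]

theorem IsResolvent.apply_of_restrictTo {Λ : Submodule ℂ (K × K)} {z : ℂ} {R : H →L[ℂ] H}
    (h : IsResolvent (restrictTo T Γ₁ Γ₂ Λ) z R) {φ : T.domain} (hφ : (Γ₁ φ, Γ₂ φ) ∈ Λ) :
    R (T φ - z • (φ : H)) = φ := by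
  have := h.2 ⟨φ, (mem_restrictTo_domain φ).2 hφ⟩
  rwa [restrictTo_apply _ φ rfl] at this

/-- Outside the spectrum of the reference operator, a defect element is determined by its
`Γ¹`-boundary value, which is arbitrary. -/
theorem bijective_domRestrict_defect (hΓ : Function.Surjective Γ₁) {z : ℂ}
    (hz : z ∈ rho (restrictTo T Γ₁ Γ₂ (Submodule.prod ⊥ ⊤))) :
    Function.Bijective (Γ₁.domRestrict (defect T z)) := by
  obtain ⟨R, hR⟩ := hz
  refine ⟨(injective_iff_map_eq_zero _).2 fun φ hφ => ?_, fun ξ => ?_⟩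
  · have h1 := hR.apply_of_restrictTo (φ := (φ : T.domain)) ⟨hφ, trivial⟩
    rw [mem_defect.1 φ.2, sub_self, map_zero] at h1
    exact Subtype.ext (Subtype.ext h1.symm)
  · obtain ⟨φ, rfl⟩ := hΓ ξ
    obtain ⟨ψ, -, hm, hψ⟩ := hR.exists_of_restrictTo (T φ - z • (φ : H))
    refine ⟨⟨φ - ψ, mem_defect.2 ?_⟩, ?_⟩
    · rw [LinearPMap.map_sub, Submodule.coe_sub, smul_sub]
      have : T ψ = T φ - z • (φ : H) + z • (ψ : H) := by rw [← hψ]; abel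
      rw [this]
      abel
    · have h0 : Γ₁ ψ = 0 := hm.1
      rw [LinearMap.domRestrict_apply, map_sub, h0, sub_zero]

theorem kreinGammaDom_mem_defect (z : ℂ) (ξ : K) : kreinGammaDom T Γ₁ z ξ ∈ defect T z := by
  unfold kreinGammaDom
  split_ifs with h
  · exact ((LinearEquiv.ofBijective _ h).symm ξ).2
  · exact Submodule.zero_mem _

/-- `γ(z)` is a right inverse of `Γ¹`; without bijectivity `kreinGammaDom` is the junk value `0`. -/
theorem gamma1_kreinGammaDom {z : ℂ} (h : Function.Bijective (Γ₁.domRestrict (defect T z)))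
    (ξ : K) : Γ₁ (kreinGammaDom T Γ₁ z ξ) = ξ := by
  rw [kreinGammaDom, dif_pos h]
  exact (LinearEquiv.ofBijective _ h).apply_symm_apply ξ

theorem kreinGammaDom_gamma1 {z : ℂ} (h : Function.Bijective (Γ₁.domRestrict (defect T z)))
    {φ : T.domain} (hφ : φ ∈ defect T z) : kreinGammaDom T Γ₁ z (Γ₁ φ) = φ :=
  congrArg Subtype.val (h.1 (a₁ := ⟨_, kreinGammaDom_mem_defect z (Γ₁ φ)⟩) (a₂ := ⟨φ, hφ⟩)
    (gamma1_kreinGammaDom h _))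

/-- The eigenvalue criterion: the eigenvectors at `z` of the restriction of `T` to
`L₁ Γ¹ φ = L₂ Γ² φ` correspond under `Γ¹` to the kernel of `L₁ - L₂ Q(z)`. -/
theorem mem_pointSpectrum_restrictTo_iff {L₁ L₂ : K →ₗ[ℂ] K} {z : ℂ}
    (h : Function.Bijective (Γ₁.domRestrict (defect T z))) :
    z ∈ pointSpectrum (restrictTo T Γ₁ Γ₂ (LinearMap.eqLocus (L₁ ∘ₗ LinearMap.fst ℂ K K)
      (L₂ ∘ₗ LinearMap.snd ℂ K K))) ↔
      ∃ ξ, ξ ≠ 0 ∧ (L₁ - L₂ ∘ₗ kreinQ T Γ₁ Γ₂ z) ξ = 0 := by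
  constructor
  · rintro ⟨φ, h0, hφ⟩
    obtain ⟨ψ, hψ, hm⟩ := exists_of_mem_restrictTo_domain φ
    rw [restrictTo_apply φ ψ hψ, hψ] at hφ
    have hd := mem_defect.2 hφ
    refine ⟨Γ₁ ψ, fun h1 => h0 (Subtype.ext ?_), ?_⟩
    · rw [hψ, ← kreinGammaDom_gamma1 h hd, h1, map_zero]
      rfl
    · change L₁ (Γ₁ ψ) - L₂ (Γ₂ (kreinGammaDom T Γ₁ z (Γ₁ ψ))) = 0
      rw [kreinGammaDom_gamma1 h hd]
      exact sub_eq_zero.2 hm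
  · rintro ⟨ξ, h0, hξ⟩
    have hd := kreinGammaDom_mem_defect (T := T) (Γ₁ := Γ₁) z ξ
    have hm := (mem_restrictTo_domain (Γ₁ := Γ₁) (Γ₂ := Γ₂) (Λ := LinearMap.eqLocus
      (L₁ ∘ₗ LinearMap.fst ℂ K K) (L₂ ∘ₗ LinearMap.snd ℂ K K)) (kreinGammaDom T Γ₁ z ξ)).2 (by
        change L₁ (Γ₁ _) = L₂ (Γ₂ _)
        rw [gamma1_kreinGammaDom h]
        exact sub_eq_zero.1 hξ)
    refine ⟨⟨_, hm⟩, fun h1 => h0 ?_, ?_⟩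
    · have h2 := congrArg Subtype.val h1
      have h3 : kreinGammaDom T Γ₁ z ξ = 0 := Subtype.ext h2
      rw [← gamma1_kreinGammaDom h ξ, h3, map_zero]
    · rw [restrictTo_apply _ _ rfl, mem_defect.1 hd]

variable [CompleteSpace H] [FiniteDimensional ℂ K]

/-- Green's identity makes `γ(z̄)^*` the map `f ↦ Γ² (T⁰ - z)⁻¹ f`. -/
theorem adjoint_kreinGamma_apply [CompleteSpace K]
    (green : ∀ φ ψ : T.domain,
      ⟪(ψ : H), T φ⟫_ℂ - ⟪T ψ, (φ : H)⟫_ℂ = ⟪Γ₁ ψ, Γ₂ φ⟫_ℂ - ⟪Γ₂ ψ, Γ₁ φ⟫_ℂ)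
    {z : ℂ} (h : Function.Bijective (Γ₁.domRestrict (defect T (conj z)))) {φ : T.domain}
    (hφ : Γ₁ φ = 0) :
    (kreinGamma T Γ₁ (conj z)).adjoint (T φ - z • (φ : H)) = Γ₂ φ := by
  refine ext_inner_left ℂ fun ξ => ?_
  rw [ContinuousLinearMap.adjoint_inner_right]
  change ⟪(kreinGammaDom T Γ₁ (conj z) ξ : H), _⟫_ℂ = _
  have hg := green φ (kreinGammaDom T Γ₁ (conj z) ξ)
  rw [hφ, inner_zero_right, sub_zero, gamma1_kreinGammaDom h,
    mem_defect.1 (kreinGammaDom_mem_defect _ ξ), inner_smul_left,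
    Complex.conj_conj] at hg
  rw [inner_sub_right, inner_smul_right, hg]

/-- Krein's resolvent formula, for a restriction of `T` to `L₁ Γ¹ φ = L₂ Γ² φ` for which
`L₁ - L₂ Q(z)` has the inverse `M`. -/
theorem isResolvent_krein [CompleteSpace K] (hΓ : Function.Surjective Γ₁)
    (green : ∀ φ ψ : T.domain,
      ⟪(ψ : H), T φ⟫_ℂ - ⟪T ψ, (φ : H)⟫_ℂ = ⟪Γ₁ ψ, Γ₂ φ⟫_ℂ - ⟪Γ₂ ψ, Γ₁ φ⟫_ℂ)
    {L₁ L₂ : K →ₗ[ℂ] K} {z : ℂ} (hz : z ∈ rho (restrictTo T Γ₁ Γ₂ (Submodule.prod ⊥ ⊤)))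
    (hz' : conj z ∈ rho (restrictTo T Γ₁ Γ₂ (Submodule.prod ⊥ ⊤))) {M : K →L[ℂ] K}
    (hM : ∀ ξ, (L₁ - L₂ ∘ₗ kreinQ T Γ₁ Γ₂ z) (M ξ) = L₂ ξ)
    (hinj : Function.Injective (L₁ - L₂ ∘ₗ kreinQ T Γ₁ Γ₂ z)) :
    IsResolvent (restrictTo T Γ₁ Γ₂ (LinearMap.eqLocus (L₁ ∘ₗ LinearMap.fst ℂ K K)
      (L₂ ∘ₗ LinearMap.snd ℂ K K))) z
      (resolventOp (restrictTo T Γ₁ Γ₂ (Submodule.prod ⊥ ⊤)) z +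
        kreinGamma T Γ₁ z ∘L M ∘L (kreinGamma T Γ₁ (conj z)).adjoint) := by
  set R := resolventOp (restrictTo T Γ₁ Γ₂ (Submodule.prod ⊥ ⊤)) z with hRdef
  have hR : IsResolvent _ z R := isResolvent_resolventOp hz
  have hb := bijective_domRestrict_defect hΓ hz
  have hb' := bijective_domRestrict_defect hΓ hz'
  -- the right-hand side maps `f` to a solution `φ` of `(T - z) φ = f` with the boundary condition
  have key : ∀ f : H, ∃ φ : T.domain,
      (φ : H) = (R + kreinGamma T Γ₁ z ∘L M ∘L (kreinGamma T Γ₁ (conj z)).adjoint) f ∧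
      L₁ (Γ₁ φ) = L₂ (Γ₂ φ) ∧ T φ - z • (φ : H) = f := by
    intro f
    obtain ⟨φ, hφ, ⟨h1, -⟩, hf⟩ := hR.exists_of_restrictTo f
    replace h1 : Γ₁ φ = 0 := h1
    set ξ := M (Γ₂ φ) with hξ
    have hd := kreinGammaDom_mem_defect (T := T) (Γ₁ := Γ₁) z ξ
    refine ⟨φ + kreinGammaDom T Γ₁ z ξ, ?_, ?_, ?_⟩
    · have := adjoint_kreinGamma_apply green hb' h1
      rw [hf] at this
      change (φ : H) + (kreinGammaDom T Γ₁ z ξ : H) =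
        R f + (kreinGammaDom T Γ₁ z (M ((kreinGamma T Γ₁ (conj z)).adjoint f)) : H)
      rw [this, hφ]
    · have := hM (Γ₂ φ)
      change L₁ ξ - L₂ (Γ₂ (kreinGammaDom T Γ₁ z ξ)) = _ at this
      rw [map_add Γ₁, map_add Γ₂, h1, zero_add, gamma1_kreinGammaDom hb, map_add, ← this]
      abel
    · rw [LinearPMap.map_add, Submodule.coe_add, smul_add, mem_defect.1 hd, ← hf]
      abel
  refine ⟨fun f => ?_, fun ψ => ?_⟩
  · obtain ⟨φ, hφ, hm, hf⟩ := key f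
    have hd := (mem_restrictTo_domain (Γ₁ := Γ₁) (Γ₂ := Γ₂) (Λ := LinearMap.eqLocus
      (L₁ ∘ₗ LinearMap.fst ℂ K K) (L₂ ∘ₗ LinearMap.snd ℂ K K)) φ).2 hm
    refine ⟨hφ ▸ hd, ?_⟩
    rw [restrictTo_apply _ φ hφ.symm, ← hφ, hf]
  · obtain ⟨ψ', hψ, hm⟩ := exists_of_mem_restrictTo_domain ψ
    obtain ⟨φ, hφ, hm', hf⟩ := key (T ψ' - z • (ψ' : H))
    rw [restrictTo_apply _ ψ' hψ, hψ, ← hφ]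
    -- uniqueness: the difference is a defect element whose boundary value is in a trivial kernel
    have hd : φ - ψ' ∈ defect T z := mem_defect.2 (by
      rw [LinearPMap.map_sub, Submodule.coe_sub, smul_sub]
      have : T φ = T ψ' - z • (ψ' : H) + z • (φ : H) := by rw [← hf]; abel
      rw [this]
      abel)
    have h0 : Γ₁ (φ - ψ') = 0 := by
      refine hinj ?_
      rw [map_zero]
      change L₁ (Γ₁ (φ - ψ')) - L₂ (Γ₂ (kreinGammaDom T Γ₁ z (Γ₁ (φ - ψ')))) = 0
      rw [kreinGammaDom_gamma1 hb hd]
      have hm2 : L₁ (Γ₁ ψ') = L₂ (Γ₂ ψ') := hm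
      simp only [map_sub, hm2, hm', sub_self]
    have h1 := kreinGammaDom_gamma1 hb hd
    rw [h0, map_zero] at h1
    rw [sub_eq_zero.1 h1.symm]

end AbstractOperators

/-! ### Integration by parts on the edges and Green's identity -/

namespace MetricGraph

variable {V E : Type*} (G : MetricGraph V E) {N : ℕ}

/-- The edge `j` of an incident pair `(j, v)`. -/
def edge (q : G.Incidence) : E := Prod.fst q.1

/-- The vertex `v` of an incident pair `(j, v)`. -/
def vertex (q : G.Incidence) : V := Prod.snd q.1

variable {G}

theorem tail_or_head (q : G.Incidence) :
    G.tail (G.edge q) = G.vertex q ∨ G.head (G.edge q) = G.vertex q := q.2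

theorem incidence_ext {q q' : G.Incidence} (h : G.edge q = G.edge q')
    (h' : G.vertex q = G.vertex q') : q = q' := Subtype.ext (Prod.ext h h')

theorem eq_of_tail {q q' : G.Incidence} (he : G.edge q = G.edge q')
    (h : G.tail (G.edge q) = G.vertex q) (h' : G.tail (G.edge q') = G.vertex q') : q = q' :=
  incidence_ext he (WithTop.coe_injective (by rw [← h, ← h', he]))

theorem eq_of_head {q q' : G.Incidence} (he : G.edge q = G.edge q')
    (h : G.head (G.edge q) = G.vertex q) (h' : G.head (G.edge q') = G.vertex q') : q = q' :=
  incidence_ext he (WithTop.coe_injective (by rw [← h, ← h', he]))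

theorem exists_incidence_tail {j : E} (h : G.tail j ≠ ⊤) :
    ∃ q : G.Incidence, G.edge q = j ∧ G.tail (G.edge q) = G.vertex q := by
  obtain ⟨v, hv⟩ := WithTop.ne_top_iff_exists.1 h
  exact ⟨⟨(j, v), Or.inl hv.symm⟩, rfl, hv.symm⟩

theorem exists_incidence_head {j : E} (h : G.head j ≠ ⊤) :
    ∃ q : G.Incidence, G.edge q = j ∧ G.head (G.edge q) = G.vertex q := by
  obtain ⟨v, hv⟩ := WithTop.ne_top_iff_exists.1 h
  exact ⟨⟨(j, v), Or.inr hv.symm⟩, rfl, hv.symm⟩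

theorem sign_of_tail {q : G.Incidence} (h : G.tail (G.edge q) = G.vertex q) : G.sign q = -1 :=
  if_pos h

theorem endpoint_of_tail {q : G.Incidence} (h : G.tail (G.edge q) = G.vertex q) :
    G.endpoint q = G.left (G.edge q) := if_pos h

theorem sign_of_head {q : G.Incidence} (h : G.head (G.edge q) = G.vertex q) : G.sign q = 1 :=
  if_neg fun h' => G.tail_ne_head (G.edge q) (Eq.trans h' h.symm)

theorem endpoint_of_head {q : G.Incidence} (h : G.head (G.edge q) = G.vertex q) :
    G.endpoint q = G.right (G.edge q) :=
  if_neg fun h' => G.tail_ne_head (G.edge q) (Eq.trans h' h.symm)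

theorem endpoint_mem_closure_interval_edge (q : G.Incidence) :
    G.endpoint q ∈ closure (G.interval (G.edge q)) := G.endpoint_mem_closure q

/-- The two ends of an edge sit at different points. -/
theorem endpoint_injOn {q q' : G.Incidence} (he : G.edge q = G.edge q')
    (h : G.endpoint q = G.endpoint q') : q = q' := by
  have hlt : ∀ {p p' : G.Incidence}, G.edge p = G.edge p' → G.tail (G.edge p) = G.vertex p →
      G.head (G.edge p') = G.vertex p' → G.endpoint p < G.endpoint p' := fun e h h' => by
    rw [endpoint_of_tail h, endpoint_of_head h', e]
    exact G.left_lt_right _ (by rw [← e, h]; exact WithTop.coe_ne_top)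
      (by rw [h']; exact WithTop.coe_ne_top)
  rcases tail_or_head q with h1 | h1 <;> rcases tail_or_head q' with h2 | h2
  · exact eq_of_tail he h1 h2
  · exact absurd h (hlt he h1 h2).ne
  · exact absurd h (hlt he.symm h2 h1).ne'
  · exact eq_of_head he h1 h2

variable (G)

open Classical in
/-- The fundamental theorem of calculus on an edge: infinite ends contribute nothing. -/
theorem setIntegral_interval (ν : Fin N ≃ G.Incidence) (j : E) {u g : ℝ → ℂ}
    (hu : IsPrimitive u g) (hui : IntegrableOn u (G.interval j))
    (hg : IntegrableOn g (G.interval j)) :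
    ∫ x in G.interval j, g x =
      ∑ n with G.edge (ν n) = j, G.sign (ν n) * u (G.endpoint (ν n)) := by
  by_cases ht : G.tail j = ⊤ <;> by_cases hh : G.head j = ⊤
  · exact absurd (ht.trans hh.symm) (G.tail_ne_head j)
  · obtain ⟨q, rfl, hq⟩ := exists_incidence_head hh
    have hI : G.interval (G.edge q) = Iio (G.right (G.edge q)) := by
      ext x; simp [interval, ht, hh]
    have hs : (Finset.univ.filter fun n => G.edge (ν n) = G.edge q) = {ν.symm q} := by
      ext n
      simp only [Finset.mem_filter, Finset.mem_univ, true_and, Finset.mem_singleton,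
        Equiv.eq_symm_apply]
      refine ⟨fun hn => ?_, fun hn => by rw [hn]⟩
      rcases tail_or_head (ν n) with h | h
      · rw [hn, ht] at h
        exact absurd h.symm WithTop.coe_ne_top
      · exact eq_of_head hn h hq
    rw [hI] at hui hg ⊢
    rw [hu.setIntegral_Iio hui hg, hs, Finset.sum_singleton, Equiv.apply_symm_apply,
      sign_of_head hq, endpoint_of_head hq, one_mul]
  · obtain ⟨q, rfl, hq⟩ := exists_incidence_tail ht
    have hI : G.interval (G.edge q) = Ioi (G.left (G.edge q)) := by
      ext x; simp [interval, ht, hh]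
    have hs : (Finset.univ.filter fun n => G.edge (ν n) = G.edge q) = {ν.symm q} := by
      ext n
      simp only [Finset.mem_filter, Finset.mem_univ, true_and, Finset.mem_singleton,
        Equiv.eq_symm_apply]
      refine ⟨fun hn => ?_, fun hn => by rw [hn]⟩
      rcases tail_or_head (ν n) with h | h
      · exact eq_of_tail hn h hq
      · rw [hn, hh] at h
        exact absurd h.symm WithTop.coe_ne_top
    rw [hI] at hui hg ⊢
    rw [hu.setIntegral_Ioi hui hg, hs, Finset.sum_singleton, Equiv.apply_symm_apply,
      sign_of_tail hq, endpoint_of_tail hq, neg_one_mul]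
  · have hlt := G.left_lt_right j ht hh
    obtain ⟨q, rfl, hq⟩ := exists_incidence_tail ht
    obtain ⟨q', he, hq'⟩ := exists_incidence_head hh
    have hI : G.interval (G.edge q) = Ioo (G.left (G.edge q)) (G.right (G.edge q)) := by
      ext x; simp [interval, ht, hh]
    have hs : (Finset.univ.filter fun n => G.edge (ν n) = G.edge q) =
        {ν.symm q, ν.symm q'} := by
      ext n
      simp only [Finset.mem_filter, Finset.mem_univ, true_and, Finset.mem_singleton,
        Finset.mem_insert, Equiv.eq_symm_apply]
      refine ⟨fun hn => ?_, fun hn => by rcases hn with hn | hn <;> rw [hn]; exact he⟩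
      rcases tail_or_head (ν n) with h | h
      · exact Or.inl (eq_of_tail hn h hq)
      · exact Or.inr (eq_of_head (hn.trans he.symm) h hq')
    have hne : ν.symm q ≠ ν.symm q' := fun h => by
      obtain rfl := ν.symm.injective h
      exact G.tail_ne_head _ (hq.trans hq'.symm)
    rw [hI, hu.setIntegral_Ioo hlt.le, hs, Finset.sum_pair hne, Equiv.apply_symm_apply,
      Equiv.apply_symm_apply, sign_of_tail hq, endpoint_of_tail hq, sign_of_head hq',
      endpoint_of_head hq', he]
    ring

end MetricGraph

theorem coeFn_matAct {I : Set ℝ} (M : Matrix (Fin 2) (Fin 2) ℂ) (f : L2 I) :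
    matAct M f =ᵐ[volume.restrict I] fun x => Matrix.toEuclideanCLM (n := Fin 2) (𝕜 := ℂ) M (f x) :=
  ContinuousLinearMap.coeFn_compLpL _ _

theorem inner_matAct {I : Set ℝ} {M : Matrix (Fin 2) (Fin 2) ℂ} (hM : M.IsHermitian)
    (f g : L2 I) : ⟪matAct M f, g⟫_ℂ = ⟪f, matAct M g⟫_ℂ := by
  rw [L2.inner_def, L2.inner_def]
  refine integral_congr_ae ?_
  filter_upwards [coeFn_matAct M f, coeFn_matAct M g] with x h1 h2
  rw [h1, h2]
  have h3 := ContinuousLinearMap.adjoint_inner_right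
    (Matrix.toEuclideanCLM (n := Fin 2) (𝕜 := ℂ) M) (f x) (g x)
  rw [← h3, ← ContinuousLinearMap.star_eq_adjoint, ← map_star, Matrix.star_eq_conjTranspose, hM]

theorem pauli1_isHermitian : pauli1.IsHermitian := by
  ext i j; fin_cases i <;> fin_cases j <;> simp [pauli1]

theorem pauli3_isHermitian : pauli3.IsHermitian := by
  ext i j; fin_cases i <;> fin_cases j <;> simp [pauli3]

theorem toEuclideanCLM_pauli1 (s : Spinor) :
    Matrix.toEuclideanCLM (n := Fin 2) (𝕜 := ℂ) pauli1 s = !₂[s 1, s 0] := by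
  ext i
  rw [Matrix.ofLp_toEuclideanCLM]
  fin_cases i <;> simp [pauli1, Matrix.mulVec, dotProduct]

theorem toEuclideanCLM_pauli3 (s : Spinor) :
    Matrix.toEuclideanCLM (n := Fin 2) (𝕜 := ℂ) pauli3 s = !₂[s 0, -s 1] := by
  ext i
  rw [Matrix.ofLp_toEuclideanCLM]
  fin_cases i <;> simp [pauli3, Matrix.mulVec, dotProduct]

theorem inner_toEuclideanCLM_pauli1 (s t : Spinor) :
    ⟪s, Matrix.toEuclideanCLM (n := Fin 2) (𝕜 := ℂ) pauli1 t⟫_ℂ =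
      conj (s 0 : ℂ) * t 1 + conj (s 1 : ℂ) * t 0 := by
  rw [toEuclideanCLM_pauli1]
  simp [PiLp.inner_apply, Fin.sum_univ_two, mul_comm]

/-- The product rule for the pairing `⟨u, σ₁ v⟩`. -/
theorem IsPrimitive.inner_pauli1 {u v g h : ℝ → Spinor} (hu : IsPrimitive u g)
    (hv : IsPrimitive v h) :
    IsPrimitive (fun x => ⟪u x, Matrix.toEuclideanCLM (n := Fin 2) (𝕜 := ℂ) pauli1 (v x)⟫_ℂ)
      (fun x => ⟪u x, Matrix.toEuclideanCLM (n := Fin 2) (𝕜 := ℂ) pauli1 (h x)⟫_ℂ +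
        ⟪g x, Matrix.toEuclideanCLM (n := Fin 2) (𝕜 := ℂ) pauli1 (v x)⟫_ℂ) := by
  have hp : ∀ {w k : ℝ → Spinor} (i : Fin 2), IsPrimitive w k →
      IsPrimitive (fun x => w x i) (fun x => k x i) := fun i hw =>
    hw.clm_apply ((EuclideanSpace.proj (𝕜 := ℂ) i).restrictScalars ℝ)
  have hc : ∀ {w k : ℝ → Spinor} (i : Fin 2), IsPrimitive w k →
      IsPrimitive (fun x => conj (w x i)) (fun x => conj (k x i)) := fun i hw =>
    (hp i hw).clm_apply (Complex.conjCLE : ℂ →L[ℝ] ℂ)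
  have key := ((hc 0 hu).smul (hp 1 hv)).add ((hc 1 hu).smul (hp 0 hv))
  simp only [inner_toEuclideanCLM_pauli1]
  convert key using 2 with x
  simp only [smul_eq_mul]
  ring

namespace MetricGraph

variable {V E : Type*} (G : MetricGraph V E) {N : ℕ}

/-- An element of `H¹` of an edge is represented by a primitive of its weak derivative. -/
theorem exists_isPrimitive_of_mem_sobolevH1 {j : E} {f : L2 (G.interval j)}
    (hf : f ∈ sobolevH1 (G.interval j)) :
    ∃ u, IsPrimitive u ((G.interval j).indicator (weakDeriv f)) ∧
      f =ᵐ[volume.restrict (G.interval j)] u :=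
  (isWeakDeriv_weakDeriv hf).exists_isPrimitive (G.isOpen_interval j) (G.ordConnected_interval j)
    f.locallyIntegrable (weakDeriv f).locallyIntegrable

open Classical in
/-- Integration by parts on an edge. -/
theorem inner_matAct_weakDeriv_add (ν : Fin N ≃ G.Incidence) {j : E} {f g : L2 (G.interval j)}
    (hf : f ∈ sobolevH1 (G.interval j)) (hg : g ∈ sobolevH1 (G.interval j)) :
    ⟪f, matAct pauli1 (weakDeriv g)⟫_ℂ + ⟪weakDeriv f, matAct pauli1 g⟫_ℂ =
      ∑ n with G.edge (ν n) = j, G.sign (ν n) *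
        (conj (boundaryValue f (G.endpoint (ν n)) 0 : ℂ) * boundaryValue g (G.endpoint (ν n)) 1 +
          conj (boundaryValue f (G.endpoint (ν n)) 1 : ℂ) *
            boundaryValue g (G.endpoint (ν n)) 0) := by
  obtain ⟨u, hu, hfu⟩ := G.exists_isPrimitive_of_mem_sobolevH1 hf
  obtain ⟨v, hv, hgv⟩ := G.exists_isPrimitive_of_mem_sobolevH1 hg
  have hI := (G.isOpen_interval j).measurableSet
  have huv := hu.inner_pauli1 hv
  have h1 := L2.integrable_inner (𝕜 := ℂ) f (matAct pauli1 (weakDeriv g))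
  have h2 := L2.integrable_inner (𝕜 := ℂ) (weakDeriv f) (matAct pauli1 g)
  have h3 := L2.integrable_inner (𝕜 := ℂ) f (matAct pauli1 g)
  have e : (fun x => ⟪f x, (matAct pauli1 (weakDeriv g)) x⟫_ℂ +
      ⟪weakDeriv f x, (matAct pauli1 g) x⟫_ℂ) =ᵐ[volume.restrict (G.interval j)] fun x =>
      ⟪u x, Matrix.toEuclideanCLM (n := Fin 2) (𝕜 := ℂ) pauli1
        ((G.interval j).indicator (weakDeriv g) x)⟫_ℂ +
      ⟪(G.interval j).indicator (weakDeriv f) x,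
        Matrix.toEuclideanCLM (n := Fin 2) (𝕜 := ℂ) pauli1 (v x)⟫_ℂ := by
    filter_upwards [ae_restrict_mem hI, hfu, hgv, coeFn_matAct pauli1 g,
      coeFn_matAct pauli1 (weakDeriv g)] with x hx e1 e2 e3 e4
    rw [e3, e4, e1, e2, indicator_of_mem hx, indicator_of_mem hx]
  have e' : (fun x => ⟪f x, (matAct pauli1 g) x⟫_ℂ) =ᵐ[volume.restrict (G.interval j)] fun x =>
      ⟪u x, Matrix.toEuclideanCLM (n := Fin 2) (𝕜 := ℂ) pauli1 (v x)⟫_ℂ := by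
    filter_upwards [hfu, hgv, coeFn_matAct pauli1 g] with x e1 e2 e3
    rw [e3, e1, e2]
  rw [L2.inner_def, L2.inner_def, ← integral_add h1 h2, integral_congr_ae e,
    G.setIntegral_interval ν j huv (h3.congr e') ((h1.add h2).congr e)]
  refine Finset.sum_congr rfl fun n hn => ?_
  obtain rfl := (Finset.mem_filter.1 hn).2
  have hp := endpoint_mem_closure_interval_edge (ν n)
  rw [inner_toEuclideanCLM_pauli1,
    boundaryValue_eq (G.isOpen_interval _) hp ⟨u, hu.continuous.continuousOn, hfu, rfl⟩,
    boundaryValue_eq (G.isOpen_interval _) hp ⟨v, hv.continuous.continuousOn, hgv, rfl⟩]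

theorem diracMax_apply (m : ℝ) (Φ : (G.diracMax m).domain) (j : E) :
    G.diracMax m Φ j = (-Complex.I) • matAct pauli1 (weakDeriv ((Φ : G.Space) j)) +
      (m : ℂ) • matAct pauli3 ((Φ : G.Space) j) := rfl

variable [Fintype E]

/-- Green's identity for the boundary maps of the maximal Dirac operator. -/
theorem green (m : ℝ) (ν : Fin N ≃ G.Incidence) (Φ Ψ : (G.diracMax m).domain) :
    ⟪(Ψ : G.Space), G.diracMax m Φ⟫_ℂ - ⟪G.diracMax m Ψ, (Φ : G.Space)⟫_ℂ =
      ⟪G.bd1 ν Ψ, G.bd2 ν Φ⟫_ℂ - ⟪G.bd2 ν Ψ, G.bd1 ν Φ⟫_ℂ := by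
  classical
  have hs : ∀ q, conj (G.sign q) = G.sign q := fun q => by
    unfold sign; split_ifs <;> simp
  have e1 : ∀ j, ⟪(Ψ : G.Space) j, G.diracMax m Φ j⟫_ℂ - ⟪G.diracMax m Ψ j, (Φ : G.Space) j⟫_ℂ =
      ∑ n with G.edge (ν n) = j, -Complex.I * G.sign (ν n) *
        (conj (G.value (ν n) Ψ 0 : ℂ) * G.value (ν n) Φ 1 +
          conj (G.value (ν n) Ψ 1 : ℂ) * G.value (ν n) Φ 0) := by
    intro j
    have h := G.inner_matAct_weakDeriv_add ν (Ψ.2 j) (Φ.2 j)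
    rw [diracMax_apply, diracMax_apply, inner_add_left, inner_add_right, inner_smul_left,
      inner_smul_left, inner_smul_right, inner_smul_right, inner_matAct pauli1_isHermitian,
      inner_matAct pauli3_isHermitian, map_neg, Complex.conj_I, Complex.conj_ofReal]
    trans -Complex.I * (⟪(Ψ : G.Space) j, matAct pauli1 (weakDeriv ((Φ : G.Space) j))⟫_ℂ +
      ⟪weakDeriv ((Ψ : G.Space) j), matAct pauli1 ((Φ : G.Space) j)⟫_ℂ)
    · ring
    · rw [h, Finset.mul_sum]
      refine Finset.sum_congr rfl fun n hn => ?_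
      obtain rfl := (Finset.mem_filter.1 hn).2
      rw [mul_assoc]
      rfl
  rw [PiLp.inner_apply, PiLp.inner_apply, ← Finset.sum_sub_distrib, Finset.sum_congr rfl
    fun j _ => e1 j, Finset.sum_fiberwise Finset.univ (fun n => G.edge (ν n)),
    PiLp.inner_apply, PiLp.inner_apply,
    ← Finset.sum_sub_distrib]
  refine Finset.sum_congr rfl fun n _ => ?_
  simp only [bd1, bd2, LinearMap.coe_mk, AddHom.coe_mk, RCLike.inner_apply, map_mul, map_neg,
    Complex.conj_I, hs]
  ring

end MetricGraph

/-! ### Prescribing boundary values -/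

/-- A compactly supported `C¹` function times a constant spinor, as an element of `H¹` of an open
interval. -/
theorem exists_mem_sobolevH1_eq_smul (I : Set ℝ) {χ : ℝ → ℝ} (hχ : ContDiff ℝ 1 χ)
    (hc : HasCompactSupport χ) (s : Spinor) :
    ∃ f ∈ sobolevH1 I, ∀ p, HasBoundaryValue f p (χ p • s) := by
  have hd := hχ.continuous_deriv le_rfl
  have h1 : MemLp (fun x => χ x • s) 2 (volume.restrict I) :=
    ((hχ.continuous.smul continuous_const).memLp_of_hasCompactSupport hc.smul_right).restrict I
  have h2 : MemLp (fun x => deriv χ x • s) 2 (volume.restrict I) :=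
    ((hd.smul continuous_const).memLp_of_hasCompactSupport hc.deriv.smul_right).restrict I
  have hw := ((IsPrimitive.of_deriv hχ).clm_apply
    (ContinuousLinearMap.toSpanSingleton ℝ s)).isWeakDeriv I
  exact ⟨h1.toLp, ⟨h2.toLp, hw.congr_ae h1.coeFn_toLp h2.coeFn_toLp⟩,
    fun p => ⟨_, (hχ.continuous.smul continuous_const).continuousOn, h1.coeFn_toLp, rfl⟩⟩

namespace MetricGraph

variable {V E : Type*} (G : MetricGraph V E) {N : ℕ}

/-- A smooth bump at one end of an edge realizes a unit vector as value of `Γ¹`. -/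
theorem exists_bd1_eq_single (ν : Fin N ≃ G.Incidence) (n : Fin N) :
    ∃ Φ : G.H1, G.bd1 ν Φ = EuclideanSpace.single n 1 := by
  classical
  -- the bump has to avoid the other end of the same edge
  have hs : {x | ∃ k, k ≠ n ∧ G.edge (ν k) = G.edge (ν n) ∧ G.endpoint (ν k) = x}ᶜ ∈
      𝓝 (G.endpoint (ν n)) := by
    refine IsClosed.compl_mem_nhds (Set.Finite.isClosed ?_) ?_
    · exact (Set.finite_range fun k => G.endpoint (ν k)).subset fun x ⟨k, _, _, hk⟩ => ⟨k, hk⟩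
    · rintro ⟨k, hk, he, hx⟩
      exact hk (ν.injective (endpoint_injOn he hx))
  obtain ⟨χ, hsub, hc, hχ, -, h1⟩ := exists_contDiff_tsupport_subset (n := 1) hs
  choose f hf hfv using fun j => exists_mem_sobolevH1_eq_smul (G.interval j) hχ hc
    (EuclideanSpace.single 0 1)
  let Φ : G.H1 := ⟨WithLp.toLp 2 fun j => if j = G.edge (ν n) then f j else 0, fun j => by
    change (if j = G.edge (ν n) then f j else 0) ∈ _
    split_ifs
    · exact hf j
    · exact Submodule.zero_mem _⟩
  have hΦ : ∀ j, (Φ : G.Space) j = if j = G.edge (ν n) then f j else 0 := fun _ => rfl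
  refine ⟨Φ, ?_⟩
  ext k
  change boundaryValue ((Φ : G.Space) (G.edge (ν k))) (G.endpoint (ν k)) 0 = _
  have hv : ∀ {h : L2 (G.interval (G.edge (ν k)))} {c},
      HasBoundaryValue h (G.endpoint (ν k)) c → boundaryValue h (G.endpoint (ν k)) = c :=
    boundaryValue_eq (G.isOpen_interval _) (endpoint_mem_closure_interval_edge (ν k))
  by_cases he : G.edge (ν k) = G.edge (ν n)
  · rw [hΦ, if_pos he, hv (hfv _ _)]
    by_cases hk : k = n
    · subst hk
      simp [h1]
    · have h0 : χ (G.endpoint (ν k)) = 0 :=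
        image_eq_zero_of_notMem_tsupport fun h => hsub h ⟨k, hk, he, rfl⟩
      simp [h0, hk]
  · have hk : k ≠ n := fun h => he (by rw [h])
    rw [hΦ, if_neg he, hv ⟨0, continuousOn_const, Lp.coeFn_zero _ _ _, rfl⟩]
    simp [hk]

theorem bd1_surjective (ν : Fin N ≃ G.Incidence) : Function.Surjective (G.bd1 ν) := by
  choose Φ hΦ using G.exists_bd1_eq_single ν
  intro ξ
  refine ⟨∑ n, ξ n • Φ n, ?_⟩
  ext k
  simp [map_sum, hΦ, Pi.single_apply]

end MetricGraph

/-! ### Conjugation symmetry -/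

/-- The conjugate-linear involution `(φ¹, φ²) ↦ (conj φ¹, -conj φ²)` of the spinor space. -/
noncomputable def spinorConj : Spinor →SL[starRingEnd ℂ] Spinor :=
  LinearMap.mkContinuous
    { toFun := fun s => !₂[conj (s 0 : ℂ), -conj (s 1 : ℂ)]
      map_add' := fun s t => by ext i; fin_cases i <;> simp [add_comm]
      map_smul' := fun c s => by ext i; fin_cases i <;> simp }
    1 fun s => by
      simp [EuclideanSpace.norm_eq, Fin.sum_univ_two]

theorem spinorConj_apply (s : Spinor) : spinorConj s = !₂[conj (s 0 : ℂ), -conj (s 1 : ℂ)] := rfl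

theorem spinorConj_spinorConj (s : Spinor) : spinorConj (spinorConj s) = s := by
  ext i; fin_cases i <;> simp [spinorConj_apply]

/-- `spinorConj` as a real-linear map. -/
noncomputable def spinorConjReal : Spinor →L[ℝ] Spinor :=
  AddMonoidHom.toRealLinearMap (spinorConj : Spinor →+ Spinor) spinorConj.continuous

/-- The pointwise action of `spinorConj` on `L²(I; ℂ²)`. -/
noncomputable def conjL2 (I : Set ℝ) : L2 I →SL[starRingEnd ℂ] L2 I :=
  spinorConj.compLpL 2 (volume.restrict I)

section

variable {I : Set ℝ}

theorem coeFn_conjL2 (f : L2 I) : conjL2 I f =ᵐ[volume.restrict I] fun x => spinorConj (f x) :=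
  ContinuousLinearMap.coeFn_compLpL _ _

theorem conjL2_conjL2 (f : L2 I) : conjL2 I (conjL2 I f) = f := by
  refine Lp.ext ?_
  filter_upwards [coeFn_conjL2 f, coeFn_conjL2 (conjL2 I f)] with x h1 h2
  rw [h2, h1, spinorConj_spinorConj]

theorem IsWeakDeriv.conjL2 {f g : L2 I} (h : IsWeakDeriv I f g) :
    IsWeakDeriv I (conjL2 I f) (conjL2 I g) :=
  (h.clm_apply spinorConjReal f.locallyIntegrable g.locallyIntegrable).congr_ae
    (coeFn_conjL2 f) (coeFn_conjL2 g)

theorem HasBoundaryValue.conjL2 {f : L2 I} {p : ℝ} {c : Spinor} (h : HasBoundaryValue f p c) :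
    HasBoundaryValue (conjL2 I f) p (spinorConj c) := by
  obtain ⟨u, hu, hfu, rfl⟩ := h
  refine ⟨fun x => spinorConj (u x), spinorConj.continuous.comp_continuousOn hu, ?_, rfl⟩
  filter_upwards [hfu, coeFn_conjL2 f] with x h1 h2
  rw [h2, h1]

theorem matAct_pauli1_conjL2 (f : L2 I) :
    matAct pauli1 (conjL2 I f) = -conjL2 I (matAct pauli1 f) := by
  refine Lp.ext ?_
  filter_upwards [coeFn_conjL2 f, coeFn_conjL2 (matAct pauli1 f), coeFn_matAct pauli1 f,
    coeFn_matAct pauli1 (conjL2 I f), Lp.coeFn_neg (conjL2 I (matAct pauli1 f))]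
    with x h1 h2 h3 h4 h5
  rw [h5, Pi.neg_apply, h4, h2, h1, h3, toEuclideanCLM_pauli1, toEuclideanCLM_pauli1]
  ext i; fin_cases i <;> simp [spinorConj_apply]

theorem matAct_pauli3_conjL2 (f : L2 I) :
    matAct pauli3 (conjL2 I f) = conjL2 I (matAct pauli3 f) := by
  refine Lp.ext ?_
  filter_upwards [coeFn_conjL2 f, coeFn_conjL2 (matAct pauli3 f), coeFn_matAct pauli3 f,
    coeFn_matAct pauli3 (conjL2 I f)] with x h1 h2 h3 h4
  rw [h4, h2, h1, h3, toEuclideanCLM_pauli3, toEuclideanCLM_pauli3]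
  ext i; fin_cases i <;> simp [spinorConj_apply]

end

namespace MetricGraph

variable {V E : Type*} (G : MetricGraph V E) {N : ℕ}

/-- The edgewise action of `spinorConj` on the Hilbert space of the graph. -/
noncomputable def conjSpace [Fintype E] : G.Space →SL[starRingEnd ℂ] G.Space where
  toFun Φ := WithLp.toLp 2 fun j => conjL2 (G.interval j) (Φ j)
  map_add' Φ Ψ := by ext1 j; exact map_add _ _ _
  map_smul' c Φ := by ext1 j; exact map_smulₛₗ (conjL2 (G.interval j)) c (Φ j)
  cont := by fun_prop

variable [Fintype E]

theorem conjSpace_conjSpace (Φ : G.Space) : G.conjSpace (G.conjSpace Φ) = Φ := by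
  ext1 j
  exact conjL2_conjL2 _

/-- The maximal Dirac operator commutes with `conjSpace`, which preserves `ker Γ¹`. -/
theorem diracMax_conjSpace (m : ℝ) (ν : Fin N ≃ G.Incidence) (Φ : (G.diracMax m).domain) :
    ∃ h : G.conjSpace Φ ∈ (G.diracMax m).domain,
      G.diracMax m ⟨G.conjSpace Φ, h⟩ = G.conjSpace (G.diracMax m Φ) ∧
      (G.bd1 ν Φ = 0 → G.bd1 ν ⟨G.conjSpace Φ, h⟩ = 0) := by
  have hw : ∀ j, IsWeakDeriv (G.interval j) (conjL2 (G.interval j) ((Φ : G.Space) j))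
      (conjL2 (G.interval j) (weakDeriv ((Φ : G.Space) j))) := fun j =>
    (isWeakDeriv_weakDeriv (Φ.2 j)).conjL2
  refine ⟨fun j => ⟨_, hw j⟩, ?_, fun h0 => ?_⟩
  · ext1 j
    change (-Complex.I) • matAct pauli1 (weakDeriv (conjL2 (G.interval j) ((Φ : G.Space) j))) +
      (m : ℂ) • matAct pauli3 (conjL2 (G.interval j) ((Φ : G.Space) j)) =
      conjL2 (G.interval j) (G.diracMax m Φ j)
    rw [weakDeriv_eq (G.isOpen_interval j) (hw j), matAct_pauli1_conjL2, matAct_pauli3_conjL2,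
      diracMax_apply, map_add, map_smulₛₗ, map_smulₛₗ, map_neg, Complex.conj_I,
      Complex.conj_ofReal, neg_smul, smul_neg, neg_neg, neg_neg]
  · ext n
    have hb := hasBoundaryValue_boundaryValue (G.isOpen_interval (G.edge (ν n)))
      (G.ordConnected_interval _) (Φ.2 _) (G.endpoint (ν n))
    change boundaryValue (conjL2 (G.interval (G.edge (ν n))) ((Φ : G.Space) (G.edge (ν n))))
      (G.endpoint (ν n)) 0 = 0
    rw [boundaryValue_eq (G.isOpen_interval _) (endpoint_mem_closure_interval_edge (ν n)) hb.conjL2,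
      spinorConj_apply]
    have h1 : boundaryValue ((Φ : G.Space) (G.edge (ν n))) (G.endpoint (ν n)) 0 = 0 :=
      congrArg (fun ξ : EuclideanSpace ℂ (Fin N) => ξ n) h0
    simp [h1]

theorem conj_mem_rho_dirac0 {m : ℝ} {ν : Fin N ≃ G.Incidence} {z : ℂ}
    (hz : z ∈ rho (G.dirac0 m ν)) : conj z ∈ rho (G.dirac0 m ν) := by
  refine conj_mem_rho_restrictTo G.conjSpace G.conjSpace_conjSpace (fun Φ => ?_) hz
  obtain ⟨h, he, hi⟩ := G.diracMax_conjSpace m ν Φ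
  exact ⟨h, he, fun hΦ => ⟨hi hΦ.1, trivial⟩⟩

end MetricGraph

/-! ### Krein's formula for the Dirac operator -/

/-- A permutation matrix between two numberings of the same set is invertible. -/
theorem MetricGraph.isUnit_W {V E : Type*} {G : MetricGraph V E} {N : ℕ}
    (νG νF : Fin N ≃ G.Incidence) : IsUnit (MetricGraph.W νG νF) := by
  have h : MetricGraph.W νG νF * MetricGraph.W νF νG = 1 := by
    ext n k
    rw [Matrix.mul_apply, Finset.sum_eq_single (νG.symm (νF n))]
    · simp [MetricGraph.W, Matrix.one_apply, eq_comm]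
    · intro l _ hl
      have : νF n ≠ νG l := fun h => hl (by rw [h, Equiv.symm_apply_apply])
      simp [MetricGraph.W, this]
    · simp
  exact IsUnit.of_mul_eq_one _ h

/-- The pencils `A - B W Q W⁻¹` and `A W - B W Q` are simultaneously invertible. -/
theorem zero_mem_resolventSet_iff {N : ℕ} {A B W Q : Matrix (Fin N) (Fin N) ℂ} (hW : IsUnit W) :
    (0 : ℂ) ∈ resolventSet ℂ (A - B * W * Q * W⁻¹) ↔ IsUnit (A * W - B * W * Q) := by
  have hd := (Matrix.isUnit_iff_isUnit_det W).1 hW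
  have h : A * W - B * W * Q = (A - B * W * Q * W⁻¹) * W := by
    rw [sub_mul, Matrix.mul_assoc _ W⁻¹, Matrix.nonsing_inv_mul W hd, mul_one]
  rw [spectrum.mem_resolventSet_iff, map_zero, zero_sub, IsUnit.neg_iff, h]
  exact ⟨fun h => h.mul hW, fun h => isUnit_of_mul_isUnit_left h⟩

theorem exists_toEuclideanLin_eq_zero_iff {N : ℕ} {M : Matrix (Fin N) (Fin N) ℂ} :
    (∃ ξ, ξ ≠ 0 ∧ Matrix.toEuclideanLin M ξ = 0) ↔ ¬ IsUnit M := by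
  rw [Matrix.isUnit_iff_isUnit_det, isUnit_iff_ne_zero, not_not, ← Matrix.exists_mulVec_eq_zero_iff]
  constructor
  · rintro ⟨ξ, h0, h⟩
    exact ⟨ξ.ofLp, fun h1 => h0 (by ext i; exact congrFun h1 i), congrArg WithLp.ofLp h⟩
  · rintro ⟨ξ, h0, h⟩
    exact ⟨WithLp.toLp 2 ξ, fun h1 => h0 (congrArg WithLp.ofLp h1), congrArg (WithLp.toLp 2) h⟩

theorem toEuclideanLin_mul_apply {N : ℕ} (M M' : Matrix (Fin N) (Fin N) ℂ)
    (ξ : EuclideanSpace ℂ (Fin N)) :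
    Matrix.toEuclideanLin (M * M') ξ = Matrix.toEuclideanLin M (Matrix.toEuclideanLin M' ξ) := by
  exact congrArg (WithLp.toLp 2) (Matrix.mulVec_mulVec ξ.ofLp M M').symm

end DiracGraph

theorem theorem3p11 {V E : Type*} [Fintype V] [Nonempty V] [Fintype E] [Nonempty E]
    (G : DiracGraph.MetricGraph V E) (m : ℝ) (hm : 0 ≤ m)
    {N : ℕ} (νG νF : Fin N ≃ G.Incidence) (A B W : Matrix (Fin N) (Fin N) ℂ)
    (hW : W = DiracGraph.MetricGraph.W νG νF)
    (z : ℂ) (hz : z ∈ DiracGraph.rho (G.dirac0 m νG)) :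
    -- well-definedness of `γ(z)`, `Q(z)` and `γ(z̄)`
    (Function.Bijective ((G.bd1 νG).domRestrict (DiracGraph.defect (G.diracMax m) z)) ∧
      starRingEnd ℂ z ∈ DiracGraph.rho (G.dirac0 m νG) ∧
      Function.Bijective ((G.bd1 νG).domRestrict
        (DiracGraph.defect (G.diracMax m) (starRingEnd ℂ z)))) ∧
    -- (i)
    (z ∈ DiracGraph.pointSpectrum (G.diracAB m νG νF A B) ↔
      (0 : ℂ) ∈ spectrum ℂ (A - B * W * G.Q m νG z * W⁻¹)) ∧
    -- (ii)
    (z ∈ DiracGraph.rho (G.diracAB m νG νF A B) ↔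
      (0 : ℂ) ∈ resolventSet ℂ (A - B * W * G.Q m νG z * W⁻¹)) ∧
    (z ∈ DiracGraph.rho (G.diracAB m νG νF A B) →
      IsUnit (A * W - B * W * G.Q m νG z) ∧
      DiracGraph.resolventOp (G.diracAB m νG νF A B) z =
        DiracGraph.resolventOp (G.dirac0 m νG) z +
          G.gammaField m νG z ∘L
            Matrix.toEuclideanCLM (n := Fin N) (𝕜 := ℂ)
              ((A * W - B * W * G.Q m νG z)⁻¹ * (B * W)) ∘L
            ContinuousLinearMap.adjoint (G.gammaField m νG (starRingEnd ℂ z))) := by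
  have hΓ : Function.Surjective (G.bd1 νG) := G.bd1_surjective νG
  have hz' := G.conj_mem_rho_dirac0 hz
  have hb := DiracGraph.bijective_domRestrict_defect (T := G.diracMax m) (Γ₁ := G.bd1 νG)
    (Γ₂ := G.bd2 νG) hΓ hz
  have hb' := DiracGraph.bijective_domRestrict_defect (T := G.diracMax m) (Γ₁ := G.bd1 νG)
    (Γ₂ := G.bd2 νG) hΓ hz'
  have hWu : IsUnit W := hW ▸ DiracGraph.MetricGraph.isUnit_W νG νF
  have hres := DiracGraph.zero_mem_resolventSet_iff (A := A) (B := B) (Q := G.Q m νG z) hWu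
  set M := A * W - B * W * G.Q m νG z with hM
  -- the matrix `M` represents the abstract pencil `A W - B W Q(z)`
  have hpencil : Matrix.toEuclideanLin (A * W) - Matrix.toEuclideanLin (B * W) ∘ₗ
      DiracGraph.kreinQ (G.diracMax m) (G.bd1 νG) (G.bd2 νG) z = Matrix.toEuclideanLin M := by
    ext1 ξ
    rw [hM, map_sub, LinearMap.sub_apply, LinearMap.sub_apply,
      DiracGraph.toEuclideanLin_mul_apply (B * W), DiracGraph.MetricGraph.Q,
      LinearEquiv.apply_symm_apply]
    rfl
  have hp : z ∈ DiracGraph.pointSpectrum (G.diracAB m νG νF A B) ↔ ¬ IsUnit M := by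
    rw [← DiracGraph.exists_toEuclideanLin_eq_zero_iff, ← hpencil, hW]
    exact DiracGraph.mem_pointSpectrum_restrictTo_iff hb
  have hR : IsUnit M → DiracGraph.IsResolvent (G.diracAB m νG νF A B) z
      (DiracGraph.resolventOp (G.dirac0 m νG) z +
          G.gammaField m νG z ∘L
            Matrix.toEuclideanCLM (n := Fin N) (𝕜 := ℂ) (M⁻¹ * (B * W)) ∘L
            ContinuousLinearMap.adjoint (G.gammaField m νG (starRingEnd ℂ z))) := by
    intro hu
    have hd := (Matrix.isUnit_iff_isUnit_det M).1 hu
    have := DiracGraph.isResolvent_krein (T := G.diracMax m) (Γ₁ := G.bd1 νG)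
      (Γ₂ := G.bd2 νG) hΓ (G.green m νG) (L₁ := Matrix.toEuclideanLin (A * W))
      (L₂ := Matrix.toEuclideanLin (B * W)) hz hz'
      (M := Matrix.toEuclideanCLM (n := Fin N) (𝕜 := ℂ) (M⁻¹ * (B * W)))
      (by
        intro ξ
        rw [hpencil]
        change Matrix.toEuclideanLin M (Matrix.toEuclideanLin (M⁻¹ * (B * W)) ξ) = _
        rw [← DiracGraph.toEuclideanLin_mul_apply, ← mul_assoc, Matrix.mul_nonsing_inv M hd,
          one_mul])
      (by
        rw [hpencil]
        refine (injective_iff_map_eq_zero _).2 fun ξ hξ => by_contra fun h0 => ?_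
        exact DiracGraph.exists_toEuclideanLin_eq_zero_iff.1 ⟨ξ, h0, hξ⟩ hu)
    subst hW
    exact this
  have hu : z ∈ DiracGraph.rho (G.diracAB m νG νF A B) ↔ IsUnit M :=
    ⟨fun h => not_not.1 fun hn => DiracGraph.notMem_pointSpectrum_of_mem_rho h (hp.2 hn),
      fun h => ⟨_, hR h⟩⟩
  refine ⟨⟨hb, hz', hb'⟩, ?_, hu.trans hres.symm, fun h => ⟨hu.1 h, (hR (hu.1 h)).resolventOp_eq⟩⟩
  rw [hp, ← hres]
  rfl
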